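/- Let $T>1$ and put $E(T)=\cot^2\!\left(\frac{\pi}{4T}\right)$, $c(T)=\cos\frac{\pi}{T}$. For $n\in\mathbb{N}=\{0,1,2,\dots\}$ let $G_n$ be the space of $2T$-periodic functions of the form $$g(x)=\frac{\alpha_0}{2}+\sum_{k=1}^n\left(\alpha_k\cos\tfrac{\pi}{T}kx+\beta_k\sin\tfrac{\pi}{T}kx\right),\qquad \alpha_k,\beta_k\in\mathbb{C},$$ and let the continuous Fourier extension $g_n$ of $f:[-1,1]\to\mathbb{C}$ be the minimizer of $\|f-g\|_{L^2[-1,1]}$ over $g\in G_n$. Let $e(\rho)=\{\frac12(\rho^{-1}e^{-i\theta}+\rho e^{i\theta}):\theta\in[-\pi,\pi]\}$, $\rho\ge 1$, be the Bernstein ellipse, and let $m(u)=\frac12(1-c(T))u+\frac12(1+c(T))$, which maps $[-1,1]$ onto $[c(T),1]$. Let $B_T=m\big(\bigcup_{1\le r\le E(T)}e(r)\big)$; this is the closed elliptic region with foci $c(T)$ and $1$ whose boundary passes through the branch point $y=-1$ of $\cos^{-1}y$. Call $f$ sufficiently analytic (for $T$) if it extends to an analytic function on a neighbourhood of $$D_T=\{z\in\mathbb{C}:\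 |\operatorname{Re}z|\le T,\ \cos\tfrac{\pi z}{T}\in B_T\},$$ so that, with $f_e$, $f_o$ the even and odd parts of $f$, the functions $f_e(\frac T\pi\cos^{-1}y)$ and $f_o(\frac T\pi\cos^{-1}y)/\sqrt{1-y^2}$ have in $B_T$ no singularity other than the one introduced at $y=-1$ by the inverse cosine. (Every entire $f$ is sufficiently analytic for every $T>1$.) Theorem. For every $T>1$ and every $f$ that is sufficiently analytic for $T$, the continuous Fourier extension $g_n$ exists and is unique for every $n\in\mathbb{N}$, and there is a constant $c_{f,T}$, depending only on $f$ and $T$, such that $$|f(x)-g_n(x)|\le c_{f,T}\,E(T)^{-n}\qquad\text{for all } n\in\mathbb{N}\text{ and all }x\in[-1,1].$$ -/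

import Mathlib

open Set MeasureTheory

noncomputable section

namespace FourierExtension

/-- The `2T`-periodic trigonometric polynomial
`α₀ / 2 + ∑_{k=1}^n (α_k cos (π k x / T) + β_k sin (π k x / T))`. -/
def trigPoly (T : ℝ) (n : ℕ) (α β : ℕ → ℂ) (x : ℝ) : ℂ :=
  α 0 / 2 + ∑ k ∈ Finset.Icc 1 n,
    (α k * (Real.cos (Real.pi / T * k * x) : ℂ) + β k * (Real.sin (Real.pi / T * k * x) : ℂ))

/-- The space `G_n` of trigonometric polynomials of degree at most `n` and period `2T`. -/
def fourierSpace (T : ℝ) (n : ℕ) : Set (ℝ → ℂ) :=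
  {g | ∃ α β : ℕ → ℂ, g = trigPoly T n α β}

/-- `g` is a continuous Fourier extension of degree `n` of `f|_[-1,1]` to `[-T,T]`: it minimizes
`‖f - g‖` in `L²[-1,1]` over `G_n`. -/
def IsFourierExtension (T : ℝ) (n : ℕ) (f g : ℝ → ℂ) : Prop :=
  g ∈ fourierSpace T n ∧
    ∀ h ∈ fourierSpace T n,
      eLpNorm (fun x => f x - g x) 2 (volume.restrict (Icc (-1 : ℝ) 1)) ≤
        eLpNorm (fun x => f x - h x) 2 (volume.restrict (Icc (-1 : ℝ) 1))

/-- The rate `E(T) = cot² (π / (4T))`. -/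
def E (T : ℝ) : ℝ := Real.cot (Real.pi / (4 * T)) ^ 2

/-- The constant `c(T) = cos (π / T)`. -/
def c (T : ℝ) : ℝ := Real.cos (Real.pi / T)

/-- The Bernstein ellipse `e(ρ)`, with foci `±1`. -/
def bernsteinEllipse (ρ : ℝ) : Set ℂ :=
  {u | ∃ θ ∈ Icc (-Real.pi) Real.pi,
    u = 1 / 2 * ((ρ : ℂ)⁻¹ * Complex.exp (-(θ * Complex.I)) + ρ * Complex.exp (θ * Complex.I))}

/-- The compact region bounded by the Bernstein ellipse `e(ρ)`, as the union of the confocal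
ellipses `e(r)`, `1 ≤ r ≤ ρ`. -/
def closedBernsteinRegion (ρ : ℝ) : Set ℂ :=
  ⋃ r ∈ Icc (1 : ℝ) ρ, bernsteinEllipse r

/-- The affine map `m` taking `[-1,1]` to `[c(T),1]`. -/
def affineMap (T : ℝ) (u : ℂ) : ℂ := (1 - c T) / 2 * u + (1 + c T) / 2

/-- The region of the `x`-plane that corresponds, under `y = cos (π x / T)` on the strip
`|Re x| ≤ T`, to the compact elliptic region of the `y`-plane which has foci `c(T)`, `1` and has
the branch point `y = -1` of the inverse cosine on its boundary. -/
def analyticityRegion (T : ℝ) : Set ℂ :=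
  {z | |z.re| ≤ T ∧ Complex.cos (Real.pi * z / T) ∈ affineMap T '' closedBernsteinRegion (E T)}

/-- `f|_[-1,1]` is sufficiently analytic for the parameter `T`: it extends analytically to a
neighbourhood of `analyticityRegion T`, so that `f_e (T / π * arccos y)` and
`f_o (T / π * arccos y) / √(1 - y²)` have in the compact elliptic region no singularity
other than the one that the inverse cosine introduces at `y = -1`. -/
def SufficientlyAnalytic (T : ℝ) (f : ℝ → ℂ) : Prop :=
  ∃ F : ℂ → ℂ, AnalyticOnNhd ℂ F (analyticityRegion T) ∧
    ∀ x ∈ Icc (-1 : ℝ) 1, F (x : ℂ) = f x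

end FourierExtension

end

noncomputable section

namespace FourierExtension

/-! Put σ = sin(π/(2T)) and ρ = cot(π/(4T)), so that E(T) = ρ². The substitution s = sin(πx/(2T))/σ
maps [-1,1] onto itself. It turns the even part of an element of G_n into a polynomial in s of
degree at most 2n, and the odd part into √(1-σ²s²) times a polynomial of degree at most 2n-1
(`exists_polynomial_of_mem`). The Fourier extension thus splits into two weighted polynomial least
squares problems on [-1,1], with weights (1-σ²s²)^(-1/2) and (1-σ²s²)^(1/2). Both weights are
Lipschitz and bounded away from 0 because σ < 1. What has to be shown is a uniform error O(ρ^(-N))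
for N = 2n and N = 2n-1, without any algebraic factor in N.

In the s-plane the transformed parts of f (the odd one divided by √(1-σ²s²)) are holomorphic inside
the Bernstein ellipse e(ρ). Its vertices ±1/σ correspond to the branch point y = -1 of y = cos(πx/T)
= 1-2σ²s², and near them the derivatives are O(|1-σ²s²|^(-3/2)). Pushing the contour of the
Chebyshev coefficients to within 1/k of the ellipse bounds them by ρ^(-k)/√k, so polynomials of
degree N reach uniform accuracy ρ^(-N)/√N (`exists_polynomial_approx`).

Going from these approximants to the least squares solution may therefore cost a factor √N and no
more. For the constant weight, the k-th Legendre term is of size k · ‖P_k‖₂ · ρ^(-k)/√k with ‖P_k‖₂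
of order 1/√k, so it is O(ρ^(-k)) and the tail is geometric (`norm_sub_legendreSum_le`). For a
weight φ with error d, orthogonality of dφ to polynomials gives φ(x) times the gap between the
Legendre sum and the weighted projection as ∫ K_N(x,t)(φ(x)-φ(t)) d(t) dt. The Lipschitz bound
supplies |x-t|, Christoffel–Darboux turns (x-t)K_N into N times Legendre polynomials, and the two
factors 1/√N from ‖P_N‖₂ and ‖d‖₂ cancel that N (`norm_sub_weighted_projection_le`). -/

/-! ### Legendre polynomials: differential equation, orthogonality, the bound |P_n| ≤ 1. -/

open Polynomial in
/-- The Legendre polynomials, by Bonnet's recurrence. -/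
def legendre : ℕ → ℝ[X]
  | 0 => 1
  | 1 => X
  | n + 2 => C ((n + 2 : ℝ)⁻¹) * (C (2 * n + 3 : ℝ) * X * legendre (n + 1)
      - C (n + 1 : ℝ) * legendre n)

/-- The value of the `n`-th Legendre polynomial at `x`. -/
def P (n : ℕ) (x : ℝ) : ℝ := (legendre n).eval x

/-- The value of the derivative of the `n`-th Legendre polynomial at `x`. -/
def P' (n : ℕ) (x : ℝ) : ℝ := (legendre n).derivative.eval x

lemma hasDerivAt_P (n : ℕ) (x : ℝ) : HasDerivAt (P n) (P' n x) x :=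
  (legendre n).hasDerivAt x

lemma continuous_P (n : ℕ) : Continuous (P n) := (legendre n).continuous

@[simp] lemma P_zero (x : ℝ) : P 0 x = 1 := by simp [P, legendre]
@[simp] lemma P_one (x : ℝ) : P 1 x = x := by simp [P, legendre]
@[simp] lemma P'_zero (x : ℝ) : P' 0 x = 0 := by simp [P', legendre]
@[simp] lemma P'_one (x : ℝ) : P' 1 x = 1 := by simp [P', legendre]

lemma P_recurrence (n : ℕ) (x : ℝ) :
    (n + 2) * P (n + 2) x = (2 * n + 3) * x * P (n + 1) x - (n + 1) * P n x := by
  have : (n + 2 : ℝ) ≠ 0 := by positivity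
  simp only [P, legendre, Polynomial.eval_mul, Polynomial.eval_sub, Polynomial.eval_C,
    Polynomial.eval_X]
  field_simp

lemma P'_recurrence (n : ℕ) (x : ℝ) :
    (n + 2) * P' (n + 2) x
      = (2 * n + 3) * (P (n + 1) x + x * P' (n + 1) x) - (n + 1) * P' n x := by
  have : (n + 2 : ℝ) ≠ 0 := by positivity
  simp only [P, P', legendre, Polynomial.derivative_mul, Polynomial.derivative_sub,
    Polynomial.derivative_C, Polynomial.derivative_X, Polynomial.eval_mul, Polynomial.eval_sub,
    Polynomial.eval_add, Polynomial.eval_C, Polynomial.eval_X, Polynomial.eval_zero,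
    Polynomial.eval_one]
  field_simp
  ring

/-- Differentiating Bonnet's recurrence and eliminating gives each identity at n+1 only with the
help of those at n, so the two are carried through one induction. -/
lemma P'_relations (n : ℕ) (x : ℝ) :
    P' (n + 1) x = x * P' n x + (n + 1) * P n x ∧
      x * P' (n + 1) x - P' n x = (n + 1) * P (n + 1) x := by
  induction n with
  | zero => simp
  | succ n ih =>
    obtain ⟨h1, h2⟩ := ih
    have r := P_recurrence n x
    have r' := P'_recurrence n x
    have hn : (n + 2 : ℝ) ≠ 0 := by positivity
    have key : P' (n + 2) x = x * P' (n + 1) x + (n + 2) * P (n + 1) x := by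
      apply mul_left_cancel₀ hn
      linear_combination r' + (n + 1) * h2
    push_cast
    refine ⟨by linear_combination key, ?_⟩
    rw [show n + 1 + 1 = n + 2 from rfl]
    linear_combination x * key - r + x * h2 - h1

lemma one_sub_sq_mul_P' (n : ℕ) (x : ℝ) :
    (1 - x ^ 2) * P' (n + 1) x = (n + 1) * (P n x - x * P (n + 1) x) := by
  obtain ⟨h1, h2⟩ := P'_relations n x
  linear_combination h1 - x * h2

/-- Legendre's differential equation in self-adjoint form. -/
lemma hasDerivAt_one_sub_sq_mul_P' (n : ℕ) (x : ℝ) :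
    HasDerivAt (fun x => (1 - x ^ 2) * P' n x) (-(n * (n + 1)) * P n x) x := by
  cases n with
  | zero => simpa using hasDerivAt_const x (0 : ℝ)
  | succ n =>
    have := ((hasDerivAt_P n x).sub ((hasDerivAt_id x).mul (hasDerivAt_P (n + 1) x))).const_mul
      (n + 1 : ℝ)
    refine (this.congr_deriv ?_).congr_of_eventuallyEq (Filter.Eventually.of_forall fun y => ?_)
    · have h2 := (P'_relations n x).2
      simp only [id]
      push_cast
      linear_combination -(n + 1 : ℝ) * h2
    · simpa using one_sub_sq_mul_P' n y

/-- Self-adjointness: the Wronskian-type expression (1-x²)(P_m' P_n - P_n' P_m) vanishes at ±1, and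
its derivative is the difference of the eigenvalues times P_m P_n. -/
lemma integral_P_mul_P_of_ne {m n : ℕ} (h : m ≠ n) : ∫ x in (-1 : ℝ)..1, P m x * P n x = 0 := by
  have h1 : ∀ x ∈ uIcc (-1 : ℝ) 1,
      HasDerivAt (fun x => (1 - x ^ 2) * P' m x * P n x - (1 - x ^ 2) * P' n x * P m x)
        (((n * (n + 1) - m * (m + 1) : ℝ)) * (P m x * P n x)) x := by
    intro x _
    refine (((hasDerivAt_one_sub_sq_mul_P' m x).mul (hasDerivAt_P n x)).sub
      ((hasDerivAt_one_sub_sq_mul_P' n x).mul (hasDerivAt_P m x))).congr_deriv ?_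
    ring
  have h2 := intervalIntegral.integral_eq_sub_of_hasDerivAt h1
    ((continuous_const.mul ((continuous_P m).mul (continuous_P n))).intervalIntegrable _ _)
  rw [intervalIntegral.integral_const_mul] at h2
  norm_num at h2
  rcases h2 with h2 | h2
  · exfalso
    have : ((n : ℝ) - m) * (n + m + 1) = 0 := by linear_combination h2
    rcases mul_eq_zero.1 this with h3 | h3
    · exact h (by exact_mod_cast (sub_eq_zero.1 h3).symm)
    · have : (0 : ℝ) < n + m + 1 := by positivity
      exact this.ne' h3
  · exact h2

/-- Bonnet's recurrence at two consecutive indices, with orthogonality, expresses ∫ x P_n P_{n+1}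
through ∫ P_n² and through ∫ P_{n+1}². Hence (2n+1)∫ P_n² does not depend on n. -/
lemma integral_P_sq (n : ℕ) : ∫ x in (-1 : ℝ)..1, P n x * P n x = 2 / (2 * n + 1) := by
  have ii : ∀ a b : ℕ, IntervalIntegrable (fun x => P a x * P b x) volume (-1) 1 := fun a b =>
    ((continuous_P a).mul (continuous_P b)).intervalIntegrable _ _
  have iix : ∀ a b : ℕ, IntervalIntegrable (fun x => x * (P a x * P b x)) volume (-1) 1 :=
    fun a b => (continuous_id.mul ((continuous_P a).mul (continuous_P b))).intervalIntegrable _ _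
  have step : ∀ n : ℕ, (2 * n + 3) * ∫ x in (-1 : ℝ)..1, P (n + 1) x * P (n + 1) x
      = (2 * n + 1) * ∫ x in (-1 : ℝ)..1, P n x * P n x := by
    intro n
    have e1 : (n + 1 : ℝ) * ∫ x in (-1 : ℝ)..1, P (n + 1) x * P (n + 1) x
        = (2 * n + 1) * ∫ x in (-1 : ℝ)..1, x * (P n x * P (n + 1) x) := by
      cases n with
      | zero => simp
      | succ k =>
        have := integral_P_mul_P_of_ne (show k ≠ k + 2 by omega)
        rw [← intervalIntegral.integral_const_mul, ← intervalIntegral.integral_const_mul]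
        have e : ∀ x : ℝ, ((k + 1 : ℕ) + 1 : ℝ) * (P (k + 1 + 1) x * P (k + 1 + 1) x)
            = (2 * (k + 1 : ℕ) + 1) * (x * (P (k + 1) x * P (k + 1 + 1) x))
              - (k + 1) * (P k x * P (k + 2) x) := by
          intro x
          have r := P_recurrence k x
          push_cast
          rw [show k + 1 + 1 = k + 2 from rfl]
          linear_combination P (k + 2) x * r
        simp_rw [e]
        rw [intervalIntegral.integral_sub ((iix _ _).const_mul _) ((ii _ _).const_mul _),
          intervalIntegral.integral_const_mul (k + 1 : ℝ), this]
        simp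
    have e2 : (2 * n + 3 : ℝ) * ∫ x in (-1 : ℝ)..1, x * (P n x * P (n + 1) x)
        = (n + 1) * ∫ x in (-1 : ℝ)..1, P n x * P n x := by
      have := integral_P_mul_P_of_ne (show n ≠ n + 2 by omega)
      rw [← intervalIntegral.integral_const_mul, ← intervalIntegral.integral_const_mul]
      have e : ∀ x : ℝ, (2 * n + 3 : ℝ) * (x * (P n x * P (n + 1) x))
          = (n + 1) * (P n x * P n x) + (n + 2) * (P n x * P (n + 2) x) := by
        intro x
        have r := P_recurrence n x
        linear_combination - P n x * r
      simp_rw [e]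
      rw [intervalIntegral.integral_add ((ii _ _).const_mul _) ((ii _ _).const_mul _),
        intervalIntegral.integral_const_mul (n + 2 : ℝ), this]
      simp
    have hn : (n + 1 : ℝ) ≠ 0 := by positivity
    apply mul_left_cancel₀ hn
    linear_combination (2 * n + 3) * e1 + (2 * n + 1) * e2
  induction n with
  | zero => norm_num
  | succ n ih =>
    have h := step n
    rw [ih] at h
    push_cast
    rw [eq_div_iff (by positivity)]
    have : (2 * n + 1 : ℝ) * (2 / (2 * n + 1)) = 2 := by field_simp
    linear_combination h + this

lemma P_at_one (n : ℕ) : P n 1 = 1 ∧ P (n + 1) 1 = 1 := by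
  induction n with
  | zero => simp
  | succ n ih =>
    refine ⟨ih.2, ?_⟩
    have r := P_recurrence n 1
    rw [ih.1, ih.2] at r
    have hn : (n + 2 : ℝ) ≠ 0 := by positivity
    apply mul_left_cancel₀ hn
    rw [r]; ring

lemma P_neg (n : ℕ) (x : ℝ) :
    P n (-x) = (-1) ^ n * P n x ∧ P (n + 1) (-x) = (-1) ^ (n + 1) * P (n + 1) x := by
  induction n with
  | zero => simp
  | succ n ih =>
    refine ⟨ih.2, ?_⟩
    have r := P_recurrence n (-x)
    have r' := P_recurrence n x
    rw [ih.1, ih.2] at r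
    have hn : (n + 2 : ℝ) ≠ 0 := by positivity
    apply mul_left_cancel₀ hn
    rw [show n + 1 + 1 = n + 2 from rfl, r]
    linear_combination -(-1 : ℝ) ^ n * r'

/-- Sonin's function: Legendre's equation cancels every term of the derivative except one with the
sign of x. Its monotonicity on [0,1] is what bounds P_{n+1} there by the value at 1. -/
lemma hasDerivAt_sonin (n : ℕ) (x : ℝ) :
    HasDerivAt (fun x => (n + 1) * (n + 2) * P (n + 1) x ^ 2 + (1 - x ^ 2) * P' (n + 1) x ^ 2)
      (2 * x * P' (n + 1) x ^ 2) x := by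
  have h1 := hasDerivAt_P (n + 1) x
  have h2 := hasDerivAt_one_sub_sq_mul_P' (n + 1) x
  have h3 : HasDerivAt (P' (n + 1)) ((legendre (n + 1)).derivative.derivative.eval x) x :=
    (legendre (n + 1)).derivative.hasDerivAt x
  set Q := (legendre (n + 1)).derivative.derivative.eval x
  have h4 : HasDerivAt (fun x : ℝ => 1 - x ^ 2) (-(2 * x)) x := by
    simpa using ((hasDerivAt_id x).pow 2).const_sub 1
  have h5 := h2.unique (h4.mul h3)
  refine (((h1.pow 2).const_mul ((n + 1) * (n + 2) : ℝ)).add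
    (h4.mul (h3.pow 2))).congr_deriv ?_
  simp only [Pi.pow_apply]
  push_cast at h5 ⊢
  linear_combination -2 * P' (n + 1) x * h5

lemma abs_P_le_one (n : ℕ) {x : ℝ} (hx : x ∈ Icc (-1 : ℝ) 1) : |P n x| ≤ 1 := by
  cases n with
  | zero => simp
  | succ n =>
    have main : ∀ y ∈ Icc (0 : ℝ) 1, |P (n + 1) y| ≤ 1 := by
      intro y hy
      have mono : MonotoneOn (fun x => (n + 1) * (n + 2) * P (n + 1) x ^ 2
          + (1 - x ^ 2) * P' (n + 1) x ^ 2) (Icc (0 : ℝ) 1) := by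
        apply monotoneOn_of_deriv_nonneg (convex_Icc _ _)
        · exact fun z _ => (hasDerivAt_sonin n z).continuousAt.continuousWithinAt
        · exact fun z _ => (hasDerivAt_sonin n z).differentiableAt.differentiableWithinAt
        · intro z hz
          rw [interior_Icc] at hz
          rw [(hasDerivAt_sonin n z).deriv]
          have := hz.1
          positivity
      have h := mono hy (right_mem_Icc.2 zero_le_one) hy.2
      simp only [(P_at_one n).2] at h
      have h0 : 0 ≤ (1 - y ^ 2) * P' (n + 1) y ^ 2 := by
        have : 0 ≤ 1 - y ^ 2 := by nlinarith [hy.1, hy.2]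
        positivity
      have h1 : ((n + 1) * (n + 2) : ℝ) * P (n + 1) y ^ 2 ≤ ((n + 1) * (n + 2) : ℝ) * 1 := by
        linarith
      have h2 := le_of_mul_le_mul_left h1 (by positivity)
      rwa [sq_le_one_iff_abs_le_one] at h2
    rcases le_total 0 x with h | h
    · exact main x ⟨h, hx.2⟩
    · have := main (-x) ⟨by linarith, by linarith [hx.1]⟩
      rwa [(P_neg n x).2, abs_mul, abs_pow, abs_neg, abs_one, one_pow, one_mul] at this

/-! ### The reproducing kernel of polynomials and the Christoffel–Darboux formula. -/

/-- The reproducing kernel of the polynomials of degree at most `N` in `L²[-1,1]`. -/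
def kernel (N : ℕ) (x t : ℝ) : ℝ :=
  ∑ k ∈ Finset.range (N + 1), (2 * k + 1) / 2 * (P k x * P k t)

lemma continuous_kernel (N : ℕ) (x : ℝ) : Continuous (kernel N x) := by
  unfold kernel
  exact continuous_finsetSum _ fun k _ =>
    continuous_const.mul (continuous_const.mul (continuous_P k))

/-- The Christoffel–Darboux formula. -/
lemma christoffel_darboux (N : ℕ) (x t : ℝ) :
    (x - t) * kernel N x t = (N + 1) / 2 * (P (N + 1) x * P N t - P N x * P (N + 1) t) := by
  induction N with
  | zero => simp [kernel]; ring
  | succ N ih =>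
    rw [kernel, Finset.sum_range_succ, ← kernel, mul_add, ih]
    have rx := P_recurrence N x
    have rt := P_recurrence N t
    push_cast
    rw [show N + 1 + 1 = N + 2 from rfl]
    linear_combination (-1 / 2) * P (N + 1) t * rx + 1 / 2 * P (N + 1) x * rt

lemma integral_kernel_mul_P {N k : ℕ} (hk : k ≤ N) (x : ℝ) :
    ∫ t in (-1 : ℝ)..1, kernel N x t * P k t = P k x := by
  unfold kernel
  simp_rw [Finset.sum_mul]
  rw [intervalIntegral.integral_finsetSum]
  · rw [Finset.sum_eq_single k]
    · have : (2 * k + 1 : ℝ) ≠ 0 := by positivity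
      simp_rw [mul_assoc]
      rw [intervalIntegral.integral_const_mul, intervalIntegral.integral_const_mul,
        integral_P_sq]
      field_simp
    · intro b _ hb
      simp_rw [mul_assoc]
      rw [intervalIntegral.integral_const_mul, intervalIntegral.integral_const_mul,
        integral_P_mul_P_of_ne hb]
      simp
    · intro h; exact absurd (Finset.mem_range.2 (by omega)) h
  · exact fun b _ => ((continuous_const.mul (continuous_const.mul (continuous_P b))).mul
      (continuous_P k)).intervalIntegrable _ _

lemma exists_pow_eq_sum_P (j : ℕ) : ∃ b : ℕ → ℝ, (∀ k, j < k → b k = 0) ∧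
    ∀ x : ℝ, x ^ j = ∑ k ∈ Finset.range (j + 1), b k * P k x := by
  induction j with
  | zero => exact ⟨fun k => if k = 0 then 1 else 0, fun k hk => by simp; omega, by simp⟩
  | succ j ih =>
    obtain ⟨b, hb, h⟩ := ih
    have hxP : ∀ (k : ℕ) (x : ℝ), x * P k x
        = (k + 1) / (2 * k + 1) * P (k + 1) x + k / (2 * k + 1) * P (k - 1) x := by
      intro k x
      cases k with
      | zero => simp
      | succ k =>
        have r := P_recurrence k x
        have : (2 * k + 3 : ℝ) ≠ 0 := by positivity
        have e : (2 * ((k + 1 : ℕ) : ℝ) + 1) = 2 * k + 3 := by push_cast; ring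
        rw [e]
        field_simp
        push_cast
        rw [show k + 1 + 1 = k + 2 from rfl]
        linear_combination -r
    -- The coefficients of x · x^j, read off from `hxP`: P_k receives a contribution from x P_{k-1}
    -- and one from x P_{k+1}. That b vanishes beyond j disposes of the boundary terms when the sums
    -- are reindexed.
    refine ⟨fun k => (if k = 0 then 0 else b (k - 1) * (k / (2 * k - 1)))
      + b (k + 1) * ((k + 1) / (2 * k + 3)), ?_, ?_⟩
    · intro k hk
      beta_reduce
      rw [hb (k - 1) (by omega), hb (k + 1) (by omega)]
      simp
    · intro x
      rw [pow_succ', h x, Finset.mul_sum]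
      have e1 : ∀ k ∈ Finset.range (j + 1), x * (b k * P k x)
          = b k * ((k + 1) / (2 * k + 1)) * P (k + 1) x
            + b k * (k / (2 * k + 1)) * P (k - 1) x := by
        intro k _
        linear_combination b k * hxP k x
      rw [Finset.sum_congr rfl e1, Finset.sum_add_distrib]
      simp only [add_mul]
      rw [Finset.sum_add_distrib]
      congr 1
      · rw [Finset.sum_range_succ' _ (j + 1)]
        simp only [Nat.add_sub_cancel, Nat.add_eq_zero_iff, one_ne_zero, and_false, if_false,
          if_true, zero_mul, add_zero]
        refine Finset.sum_congr rfl fun k _ => ?_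
        push_cast
        rw [show (2 * ((k : ℝ) + 1) - 1) = 2 * k + 1 by ring]
      · rw [Finset.sum_range_succ' _ j]
        rw [Finset.sum_range_succ _ (j + 1), Finset.sum_range_succ _ j]
        rw [hb (j + 1) (by omega), hb (j + 1 + 1) (by omega)]
        simp only [Nat.add_sub_cancel, Nat.cast_zero, zero_div, mul_zero, zero_mul, add_zero]
        refine Finset.sum_congr rfl fun k _ => ?_
        push_cast
        rw [show (2 * ((k : ℝ) + 1) + 1) = 2 * k + 3 by ring]

lemma integral_kernel_mul_pow {N j : ℕ} (hj : j ≤ N) (x : ℝ) :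
    ∫ t in (-1 : ℝ)..1, kernel N x t * t ^ j = x ^ j := by
  obtain ⟨b, -, h⟩ := exists_pow_eq_sum_P j
  simp_rw [h, Finset.mul_sum]
  rw [intervalIntegral.integral_finsetSum]
  · refine Finset.sum_congr rfl fun k hk => ?_
    rw [← integral_kernel_mul_P (show k ≤ N by have := Finset.mem_range.1 hk; omega) x,
      ← intervalIntegral.integral_const_mul]
    exact intervalIntegral.integral_congr fun t _ => by ring
  · exact fun b _ => ((continuous_kernel N x).mul
      (continuous_const.mul (continuous_P b))).intervalIntegrable _ _

/-! ### Legendre partial sums of a continuous function. -/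

section

lemma intervalIntegrable_of_continuousOn_Icc {F : Type*} [NormedAddCommGroup F] {w : ℝ → F}
    (hw : ContinuousOn w (Icc (-1 : ℝ) 1)) : IntervalIntegrable w volume (-1) 1 :=
  hw.intervalIntegrable_of_Icc (by norm_num)

lemma continuous_eval_ofReal (q : Polynomial ℂ) : Continuous fun s : ℝ => q.eval (s : ℂ) :=
  q.continuous.comp Complex.continuous_ofReal

lemma integral_mul_eval {w : ℝ → ℂ} (hw : ContinuousOn w (Icc (-1 : ℝ) 1)) {N : ℕ}
    {q : Polynomial ℂ} (hq : q.natDegree ≤ N) :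
    ∫ s in (-1 : ℝ)..1, w s * q.eval (s : ℂ)
      = ∑ j ∈ Finset.range (N + 1), q.coeff j * ∫ s in (-1 : ℝ)..1, w s * (s : ℂ) ^ j := by
  simp_rw [Polynomial.eval_eq_sum_range' (Nat.lt_succ_of_le hq), Finset.mul_sum]
  rw [intervalIntegral.integral_finsetSum]
  · refine Finset.sum_congr rfl fun j _ => ?_
    rw [← intervalIntegral.integral_const_mul]
    exact intervalIntegral.integral_congr fun t _ => by ring
  · intro j _
    apply intervalIntegrable_of_continuousOn_Icc
    fun_prop

lemma integral_kernel_mul_eval {N : ℕ} {q : Polynomial ℂ} (hq : q.natDegree ≤ N) (x : ℝ) :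
    ∫ t in (-1 : ℝ)..1, (kernel N x t : ℂ) * q.eval (t : ℂ) = q.eval (x : ℂ) := by
  rw [integral_mul_eval (w := fun t => (kernel N x t : ℂ))
    (Complex.continuous_ofReal.comp (continuous_kernel N x)).continuousOn hq,
    Polynomial.eval_eq_sum_range' (Nat.lt_succ_of_le hq)]
  refine Finset.sum_congr rfl fun j hj => ?_
  have := integral_kernel_mul_pow (show j ≤ N by have := Finset.mem_range.1 hj; omega) x
  rw [← Complex.ofReal_pow, ← this, ← intervalIntegral.integral_ofReal]
  simp

/-- The orthogonal projection of `H` onto the polynomials of degree at most `N`. -/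
def legendreSum (H : ℝ → ℂ) (N : ℕ) (x : ℝ) : ℂ :=
  ∫ t in (-1 : ℝ)..1, (kernel N x t : ℂ) * H t

variable {H : ℝ → ℂ}

lemma continuousOn_kernel_mul (hH : ContinuousOn H (Icc (-1 : ℝ) 1)) (N : ℕ) (x : ℝ) :
    ContinuousOn (fun t => (kernel N x t : ℂ) * H t) (Icc (-1 : ℝ) 1) :=
  (Complex.continuous_ofReal.comp (continuous_kernel N x)).continuousOn.mul hH

lemma continuousOn_P_mul (hH : ContinuousOn H (Icc (-1 : ℝ) 1)) (k : ℕ) :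
    ContinuousOn (fun t => (P k t : ℂ) * H t) (Icc (-1 : ℝ) 1) :=
  (Complex.continuous_ofReal.comp (continuous_P k)).continuousOn.mul hH

lemma legendreSum_succ (hH : ContinuousOn H (Icc (-1 : ℝ) 1)) (N : ℕ) (x : ℝ) :
    legendreSum H (N + 1) x = legendreSum H N x
      + ((2 * (N + 1 : ℕ) + 1) / 2 * P (N + 1) x : ℝ)
        * ∫ t in (-1 : ℝ)..1, (P (N + 1) t : ℂ) * H t := by
  rw [legendreSum, legendreSum, ← intervalIntegral.integral_const_mul,
    ← intervalIntegral.integral_add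
    (intervalIntegrable_of_continuousOn_Icc (continuousOn_kernel_mul hH N x))
    ((intervalIntegrable_of_continuousOn_Icc (continuousOn_P_mul hH (N + 1))).const_mul _)]
  refine intervalIntegral.integral_congr fun t _ => ?_
  rw [kernel, Finset.sum_range_succ, ← kernel]
  push_cast
  ring

/-- A crude bound from |P_k| ≤ 1; its quadratic growth is harmless because it only serves to show
that the Legendre sums converge. -/
lemma abs_kernel_le (N : ℕ) {x t : ℝ} (hx : x ∈ Icc (-1 : ℝ) 1) (ht : t ∈ Icc (-1 : ℝ) 1) :
    |kernel N x t| ≤ (N + 1) ^ 2 / 2 := by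
  have e : ∀ N : ℕ, ∑ k ∈ Finset.range (N + 1), (2 * k + 1 : ℝ) / 2 = (N + 1) ^ 2 / 2 := by
    intro N
    induction N with
    | zero => simp
    | succ N ih => rw [Finset.sum_range_succ, ih]; push_cast; ring
  rw [← e, kernel]
  refine (Finset.abs_sum_le_sum_abs _ _).trans (Finset.sum_le_sum fun k _ => ?_)
  rw [abs_mul, abs_mul, abs_of_nonneg (by positivity : (0 : ℝ) ≤ (2 * k + 1) / 2)]
  have := mul_le_one₀ (abs_P_le_one k hx) (abs_nonneg _) (abs_P_le_one k ht)
  exact mul_le_of_le_one_right (by positivity) this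

lemma integral_P_mul_eq_zero {k : ℕ} {q : Polynomial ℂ} (hq : q.natDegree < k) :
    ∫ t in (-1 : ℝ)..1, (P k t : ℂ) * q.eval (t : ℂ) = 0 := by
  rw [integral_mul_eval (w := fun t => (P k t : ℂ))
    (Complex.continuous_ofReal.comp (continuous_P k)).continuousOn le_rfl]
  refine Finset.sum_eq_zero fun j hj => ?_
  have hjk : j < k := by have := Finset.mem_range.1 hj; omega
  have : ∫ t in (-1 : ℝ)..1, P k t * t ^ j = 0 := by
    obtain ⟨b, -, h⟩ := exists_pow_eq_sum_P j
    simp_rw [h, Finset.mul_sum]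
    rw [intervalIntegral.integral_finsetSum]
    · refine Finset.sum_eq_zero fun i hi => ?_
      simp_rw [mul_left_comm]
      rw [intervalIntegral.integral_const_mul,
        integral_P_mul_P_of_ne (by have := Finset.mem_range.1 hi; omega), mul_zero]
    · exact fun b _ => ((continuous_P k).mul
        (continuous_const.mul (continuous_P b))).intervalIntegrable _ _
  have h2 : ∫ t in (-1 : ℝ)..1, (P k t : ℂ) * (t : ℂ) ^ j = 0 := by
    rw [← Complex.ofReal_zero, ← this, ← intervalIntegral.integral_ofReal]
    simp
  rw [h2, mul_zero]

lemma natDegree_legendre_le (n : ℕ) :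
    (legendre n).natDegree ≤ n ∧ (legendre (n + 1)).natDegree ≤ n + 1 := by
  induction n with
  | zero => simp [legendre]
  | succ n ih =>
    refine ⟨ih.2, ?_⟩
    rw [legendre]
    refine (Polynomial.natDegree_C_mul_le _ _).trans
      ((Polynomial.natDegree_sub_le _ _).trans (max_le ?_ ?_))
    · refine Polynomial.natDegree_mul_le.trans ?_
      have := Polynomial.natDegree_C_mul_le (2 * n + 3 : ℝ) Polynomial.X
      rw [Polynomial.natDegree_X] at this
      omega
    · exact (Polynomial.natDegree_C_mul_le _ _).trans (by omega)

/-- The kernel `kernel N x` as a polynomial in its second argument. -/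
def kernelPoly (N : ℕ) (x : ℝ) : Polynomial ℂ :=
  ∑ k ∈ Finset.range (N + 1),
    Polynomial.C (((2 * k + 1) / 2 * P k x : ℝ) : ℂ) * (legendre k).map (algebraMap ℝ ℂ)

lemma natDegree_kernelPoly_le (N : ℕ) (x : ℝ) : (kernelPoly N x).natDegree ≤ N := by
  refine Polynomial.natDegree_sum_le_of_forall_le _ _ fun k hk => ?_
  refine (Polynomial.natDegree_C_mul_le _ _).trans (Polynomial.natDegree_map_le.trans
    ((natDegree_legendre_le k).1.trans ?_))
  have := Finset.mem_range.1 hk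
  omega

lemma eval_kernelPoly (N : ℕ) (x t : ℝ) : (kernelPoly N x).eval (t : ℂ) = kernel N x t := by
  have : ∀ k, ((legendre k).map (algebraMap ℝ ℂ)).eval (t : ℂ) = P k t := fun k => by
    rw [← Complex.coe_algebraMap, Polynomial.eval_map, Polynomial.eval₂_at_apply]; rfl
  simp only [kernelPoly, Polynomial.eval_finsetSum, Polynomial.eval_mul, Polynomial.eval_C, this,
    kernel]
  push_cast
  exact Finset.sum_congr rfl fun k _ => by ring

/-- Weighted AM-GM, in place of the Cauchy–Schwarz inequality for integrals. The weight l is later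
the target size ρ^(-N), which makes both terms of that order after integration. -/
lemma abs_mul_le_weighted {a b l : ℝ} (hl : 0 < l) :
    |a| * b ≤ (l * (a * a) + l⁻¹ * b ^ 2) / 2 := by
  have h : 0 ≤ l⁻¹ * (l * |a| - b) ^ 2 := by positivity
  have e : l⁻¹ * (l * |a| - b) ^ 2 = l * (a * a) + l⁻¹ * b ^ 2 - 2 * (|a| * b) := by
    have : a * a = |a| * |a| := (abs_mul_abs_self a).symm
    rw [this]; field_simp; ring
  linarith

/-! ### Uniform error of Legendre sums and of weighted least squares. -/

section Approximation

variable {ρ A : ℝ} (hρ : 1 < ρ) (hH : ContinuousOn H (Icc (-1 : ℝ) 1))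
  (happ : ∀ N : ℕ, ∃ p : Polynomial ℂ, p.natDegree ≤ N ∧ ∀ s ∈ Icc (-1 : ℝ) 1,
    ‖H s - p.eval (s : ℂ)‖ ≤ A / √(N + 1) * ρ⁻¹ ^ N)

include hρ hH happ

/-- The coefficient only sees H - p for p of degree at most k. The factor k of the normalization is
cancelled by ∫ P_{k+1}² = O(1/k) together with the squared accuracy O(ρ^(-2k)/k) of p, so no power
of k survives. -/
lemma norm_legendre_coeff_le (k : ℕ) :
    (2 * (k + 1 : ℕ) + 1) / 2 * ‖∫ t in (-1 : ℝ)..1, (P (k + 1) t : ℂ) * H t‖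
      ≤ (1 + 3 * A ^ 2 * ρ ^ 2) * ρ⁻¹ ^ (k + 1) := by
  obtain ⟨p, hp, hps⟩ := happ k
  have hρ0 : 0 < ρ := by linarith
  set l : ℝ := ρ⁻¹ ^ (k + 1) with hl
  have hl0 : 0 < l := by positivity
  have e : ∫ t in (-1 : ℝ)..1, (P (k + 1) t : ℂ) * H t
      = ∫ t in (-1 : ℝ)..1, (P (k + 1) t : ℂ) * (H t - p.eval (t : ℂ)) := by
    simp_rw [mul_sub]
    rw [intervalIntegral.integral_sub
      (intervalIntegrable_of_continuousOn_Icc (continuousOn_P_mul hH _))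
      (intervalIntegrable_of_continuousOn_Icc
        (continuousOn_P_mul (continuous_eval_ofReal p).continuousOn _)),
      integral_P_mul_eq_zero (by omega), sub_zero]
  set ε := A / √(k + 1) * ρ⁻¹ ^ k with hε
  have hεsq : l⁻¹ * ε ^ 2 = A ^ 2 * ρ ^ 2 * l / (k + 1) := by
    rw [hε, mul_pow, div_pow, Real.sq_sqrt (by positivity), hl, pow_succ]
    field_simp
  have b : ‖∫ t in (-1 : ℝ)..1, (P (k + 1) t : ℂ) * (H t - p.eval (t : ℂ))‖
      ≤ ∫ t in (-1 : ℝ)..1, (l * (P (k + 1) t * P (k + 1) t) + l⁻¹ * ε ^ 2) / 2 := by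
    apply intervalIntegral.norm_integral_le_of_norm_le (by norm_num)
    · refine Filter.Eventually.of_forall fun t ht => ?_
      rw [norm_mul, Complex.norm_real, Real.norm_eq_abs]
      refine le_trans ?_ (abs_mul_le_weighted hl0)
      gcongr
      exact hps t (Ioc_subset_Icc_self ht)
    · exact (((continuous_const.mul ((continuous_P _).mul (continuous_P _))).add
        continuous_const).div_const _).intervalIntegrable _ _
  have hPP : IntervalIntegrable (fun t => P (k + 1) t * P (k + 1) t) volume (-1) 1 :=
    ((continuous_P _).mul (continuous_P _)).intervalIntegrable _ _
  rw [intervalIntegral.integral_div, intervalIntegral.integral_add (hPP.const_mul _) (by simp),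
    intervalIntegral.integral_const_mul, integral_P_sq, hεsq] at b
  rw [e]
  calc _ ≤ _ := mul_le_mul_of_nonneg_left b (by positivity)
    _ ≤ _ := by
      simp only [intervalIntegral.integral_const, smul_eq_mul]
      push_cast
      have h1 : (2 * ((k : ℝ) + 1) + 1) / (k + 1) ≤ 3 := by
        rw [div_le_iff₀ (by positivity)]; nlinarith [(Nat.cast_nonneg k : (0 : ℝ) ≤ k)]
      have h2 : (2 * ((k : ℝ) + 1) + 1) / 2 * ((l * (2 / (2 * (k + 1) + 1))
          + (1 - -1) * (A ^ 2 * ρ ^ 2 * l / (k + 1))) / 2)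
          = l / 2 + (2 * ((k : ℝ) + 1) + 1) / (k + 1) * (A ^ 2 * ρ ^ 2 * l) / 2 := by
        field_simp; ring
      rw [h2]
      have h3 := mul_le_mul_of_nonneg_right h1 (by positivity : 0 ≤ A ^ 2 * ρ ^ 2 * l)
      nlinarith [(by positivity : 0 ≤ A ^ 2 * ρ ^ 2 * l)]

lemma norm_legendreSum_sub_le (N : ℕ) {x : ℝ} (hx : x ∈ Icc (-1 : ℝ) 1) (j : ℕ) :
    ‖legendreSum H (N + j) x - legendreSum H N x‖
      ≤ ∑ i ∈ Finset.range j, (1 + 3 * A ^ 2 * ρ ^ 2) * ρ⁻¹ ^ (N + i + 1) := by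
  induction j with
  | zero => simp
  | succ j ih =>
    rw [Finset.sum_range_succ, ← add_assoc, legendreSum_succ hH, add_sub_right_comm]
    refine (norm_add_le _ _).trans (add_le_add ih ?_)
    refine le_trans ?_ (norm_legendre_coeff_le hρ hH happ (N + j))
    rw [norm_mul, Complex.norm_real, Real.norm_eq_abs, abs_mul,
      abs_of_nonneg (by positivity : (0 : ℝ) ≤ (2 * (N + j + 1 : ℕ) + 1) / 2)]
    gcongr
    exact mul_le_of_le_one_right (by positivity) (abs_P_le_one _ hx)

/-- The Legendre sum reproduces p, so the error is that of p plus its projection. The quadratic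
factor is too weak for the final rate but suffices for pointwise convergence. -/
lemma norm_sub_legendreSum_le_crude (N : ℕ) {x : ℝ} (hx : x ∈ Icc (-1 : ℝ) 1) :
    ‖H x - legendreSum H N x‖ ≤ (1 + (N + 1) ^ 2) * (|A| * ρ⁻¹ ^ N) := by
  obtain ⟨p, hp, hps⟩ := happ N
  have hρ0 : 0 < ρ := by linarith
  have hps' : ∀ s ∈ Icc (-1 : ℝ) 1, ‖H s - p.eval (s : ℂ)‖ ≤ |A| * ρ⁻¹ ^ N := by
    intro s hs
    refine (hps s hs).trans ?_
    gcongr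
    have h1 : 1 ≤ √((N : ℝ) + 1) := by
      rw [Real.one_le_sqrt]; linarith [(Nat.cast_nonneg N : (0 : ℝ) ≤ N)]
    calc A / √((N : ℝ) + 1) ≤ |A| / √((N : ℝ) + 1) := by gcongr; exact le_abs_self A
      _ ≤ |A| := div_le_self (abs_nonneg _) h1
  have e : H x - legendreSum H N x = (H x - p.eval (x : ℂ))
      - ∫ t in (-1 : ℝ)..1, (kernel N x t : ℂ) * (H t - p.eval (t : ℂ)) := by
    simp_rw [mul_sub]
    rw [intervalIntegral.integral_sub
      (intervalIntegrable_of_continuousOn_Icc (continuousOn_kernel_mul hH _ _))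
      (intervalIntegrable_of_continuousOn_Icc
        (continuousOn_kernel_mul (continuous_eval_ofReal p).continuousOn _ _)),
      integral_kernel_mul_eval hp, legendreSum]
    ring
  have b : ‖∫ t in (-1 : ℝ)..1, (kernel N x t : ℂ) * (H t - p.eval (t : ℂ))‖
      ≤ ((N + 1) ^ 2 / 2 * (|A| * ρ⁻¹ ^ N)) * |1 - (-1 : ℝ)| := by
    apply intervalIntegral.norm_integral_le_of_norm_le_const
    intro t ht
    rw [uIoc_of_le (by norm_num)] at ht
    have ht' := Ioc_subset_Icc_self ht
    rw [norm_mul, Complex.norm_real, Real.norm_eq_abs]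
    exact mul_le_mul (abs_kernel_le N hx ht') (hps' t ht') (norm_nonneg _) (by positivity)
  rw [e]
  refine (norm_sub_le _ _).trans ((add_le_add (hps' x hx) b).trans (le_of_eq ?_))
  norm_num
  ring

/-- Telescope from N to N + j with the sharp coefficient bound, finish with the crude bound at N +
j, and let j tend to infinity: the geometric tail remains and the crude term disappears. -/
lemma norm_sub_legendreSum_le (N : ℕ) {x : ℝ} (hx : x ∈ Icc (-1 : ℝ) 1) :
    ‖H x - legendreSum H N x‖ ≤ (1 + 3 * A ^ 2 * ρ ^ 2) / (1 - ρ⁻¹) * ρ⁻¹ ^ N := by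
  have hρ0 : 0 < ρ := by linarith
  have hr0 : 0 < ρ⁻¹ := by positivity
  have hr1 : ρ⁻¹ < 1 := inv_lt_one_of_one_lt₀ hρ
  have hB : 0 ≤ 1 + 3 * A ^ 2 * ρ ^ 2 := by positivity
  have key : ∀ j : ℕ, ‖H x - legendreSum H N x‖ ≤ (1 + 3 * A ^ 2 * ρ ^ 2) / (1 - ρ⁻¹) * ρ⁻¹ ^ N
      + (1 + (((N + j : ℕ) : ℝ) + 1) ^ 2) * (|A| * ρ⁻¹ ^ (N + j)) := by
    intro j
    have h1 := norm_legendreSum_sub_le hρ hH happ N hx j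
    have h2 := norm_sub_legendreSum_le_crude hρ hH happ (N + j) hx
    have h3 : ∑ i ∈ Finset.range j, (1 + 3 * A ^ 2 * ρ ^ 2) * ρ⁻¹ ^ (N + i + 1)
        ≤ (1 + 3 * A ^ 2 * ρ ^ 2) / (1 - ρ⁻¹) * ρ⁻¹ ^ N := by
      have e : ∀ i ∈ Finset.range j, (1 + 3 * A ^ 2 * ρ ^ 2) * ρ⁻¹ ^ (N + i + 1)
          = ((1 + 3 * A ^ 2 * ρ ^ 2) * ρ⁻¹ ^ N * ρ⁻¹) * ρ⁻¹ ^ i := fun i _ => by ring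
      rw [Finset.sum_congr rfl e, ← Finset.mul_sum]
      have g : ∑ i ∈ Finset.range j, ρ⁻¹ ^ i ≤ (1 - ρ⁻¹)⁻¹ := by
        rw [← tsum_geometric_of_lt_one hr0.le hr1]
        exact (summable_geometric_of_lt_one hr0.le hr1).sum_le_tsum _ fun i _ => by positivity
      calc _ ≤ ((1 + 3 * A ^ 2 * ρ ^ 2) * ρ⁻¹ ^ N * 1) * (1 - ρ⁻¹)⁻¹ := by gcongr
        _ = _ := by ring
    calc ‖H x - legendreSum H N x‖ = ‖(legendreSum H (N + j) x - legendreSum H N x)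
          + (H x - legendreSum H (N + j) x)‖ := by congr 1; ring
      _ ≤ _ := (norm_add_le _ _).trans (add_le_add (h1.trans h3) h2)
  have lim : Filter.Tendsto (fun n : ℕ => (1 + ((n : ℝ) + 1) ^ 2) * (|A| * ρ⁻¹ ^ n))
      Filter.atTop (nhds 0) := by
    have t2 := tendsto_pow_const_mul_const_pow_of_lt_one 2 hr0.le hr1
    have t1 := tendsto_pow_const_mul_const_pow_of_lt_one 1 hr0.le hr1
    have t0 := tendsto_pow_const_mul_const_pow_of_lt_one 0 hr0.le hr1
    have := ((t2.add (t1.const_mul 2)).add (t0.const_mul 2)).const_mul |A|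
    simp only [mul_zero, add_zero] at this
    refine this.congr fun n => ?_
    ring
  have lim' : Filter.Tendsto (fun j : ℕ => (1 + 3 * A ^ 2 * ρ ^ 2) / (1 - ρ⁻¹) * ρ⁻¹ ^ N
      + (1 + (((N + j : ℕ) : ℝ) + 1) ^ 2) * (|A| * ρ⁻¹ ^ (N + j))) Filter.atTop
      (nhds ((1 + 3 * A ^ 2 * ρ ^ 2) / (1 - ρ⁻¹) * ρ⁻¹ ^ N + 0)) :=
    (lim.comp (Filter.tendsto_atTop_mono (fun j => Nat.le_add_left j N)
      Filter.tendsto_id)).const_add _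
  rw [add_zero] at lim'
  exact ge_of_tendsto' lim' key

variable {φ : ℝ → ℝ} {L m M : ℝ} (hφ : ContinuousOn φ (Icc (-1 : ℝ) 1)) (hm : 0 < m)
  (hmφ : ∀ x ∈ Icc (-1 : ℝ) 1, m ≤ φ x) (hφM : ∀ x ∈ Icc (-1 : ℝ) 1, φ x ≤ M)

-- The polynomial g is the orthogonal projection of H for the weight φ, so its weighted error is at
-- most that of the good approximant p; the bounds m and M on φ remove the weight.
include hφ hm hmφ hφM in
lemma integral_norm_sq_error_le {N : ℕ} {g : Polynomial ℂ} (hg : g.natDegree ≤ N)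
    (horth : ∀ j ≤ N, ∫ s in (-1 : ℝ)..1, (H s - g.eval (s : ℂ)) * φ s * (s : ℂ) ^ j = 0) :
    ∫ s in (-1 : ℝ)..1, ‖H s - g.eval (s : ℂ)‖ ^ 2
      ≤ 2 * M / m * A ^ 2 * (ρ⁻¹ ^ N) ^ 2 / (N + 1) := by
  obtain ⟨p, hp, hps⟩ := happ N
  have hd : ContinuousOn (fun s : ℝ => H s - g.eval (s : ℂ)) (Icc (-1 : ℝ) 1) :=
    hH.sub (continuous_eval_ofReal g).continuousOn
  have hφc : ContinuousOn (fun s : ℝ => (φ s : ℂ)) (Icc (-1 : ℝ) 1) :=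
    Complex.continuous_ofReal.comp_continuousOn hφ
  -- On the real line q is the conjugate of g - p. Since it is again a polynomial of degree at most
  -- N, the bilinear orthogonality relations apply and kill the cross term in ‖(H - g) + (g - p)‖².
  set q : Polynomial ℂ := (g - p).map (starRingEnd ℂ) with hq
  have hqd : q.natDegree ≤ N :=
    Polynomial.natDegree_map_le.trans ((Polynomial.natDegree_sub_le _ _).trans (max_le hg hp))
  have hqe : ∀ s : ℝ, q.eval (s : ℂ)
      = (starRingEnd ℂ) (g.eval (s : ℂ) - p.eval (s : ℂ)) := by
    intro s
    conv_lhs => rw [hq, ← Complex.conj_ofReal s, Polynomial.eval_map,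
      Polynomial.eval₂_at_apply]
    simp
  have hz : ∫ s in (-1 : ℝ)..1, (H s - g.eval (s : ℂ)) * φ s * q.eval (s : ℂ) = 0 := by
    rw [integral_mul_eval (w := fun s => (H s - g.eval (s : ℂ)) * φ s) (hd.mul hφc) hqd]
    refine Finset.sum_eq_zero fun j hj => ?_
    rw [horth j (by have := Finset.mem_range.1 hj; omega), mul_zero]
  have hzc : ContinuousOn (fun s : ℝ => (H s - g.eval (s : ℂ)) * φ s * q.eval (s : ℂ))
      (Icc (-1 : ℝ) 1) := (hd.mul hφc).mul (continuous_eval_ofReal q).continuousOn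
  have hzre : ∫ s in (-1 : ℝ)..1, ((H s - g.eval (s : ℂ)) * φ s * q.eval (s : ℂ)).re = 0 := by
    have := intervalIntegral.intervalIntegral_re (𝕜 := ℂ)
      (intervalIntegrable_of_continuousOn_Icc hzc)
    rw [hz] at this
    simpa using this
  set ε := A / √(N + 1) * ρ⁻¹ ^ N with hε
  have hdn : ContinuousOn (fun s : ℝ => ‖H s - g.eval (s : ℂ)‖ ^ 2) (Icc (-1 : ℝ) 1) :=
    hd.norm.pow 2
  have hzrec : ContinuousOn (fun s : ℝ => ((H s - g.eval (s : ℂ)) * φ s * q.eval (s : ℂ)).re)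
      (Icc (-1 : ℝ) 1) := Complex.continuous_re.comp_continuousOn hzc
  have hpt : ∀ s ∈ Icc (-1 : ℝ) 1, m * ‖H s - g.eval (s : ℂ)‖ ^ 2
      + 2 * ((H s - g.eval (s : ℂ)) * φ s * q.eval (s : ℂ)).re ≤ M * ε ^ 2 := by
    intro s hs
    have h1 := hps s hs
    have h2 : ‖H s - p.eval (s : ℂ)‖ ^ 2 ≤ ε ^ 2 := by gcongr
    have h3 : ‖H s - p.eval (s : ℂ)‖ ^ 2 = ‖H s - g.eval (s : ℂ)‖ ^ 2
        + 2 * ((H s - g.eval (s : ℂ)) * q.eval (s : ℂ)).re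
        + ‖g.eval (s : ℂ) - p.eval (s : ℂ)‖ ^ 2 := by
      rw [hqe]
      simp only [← Complex.normSq_eq_norm_sq, Complex.normSq_apply, Complex.mul_re,
        Complex.conj_re, Complex.conj_im, Complex.sub_re, Complex.sub_im]
      ring
    have h4 : ((H s - g.eval (s : ℂ)) * φ s * q.eval (s : ℂ)).re
        = φ s * ((H s - g.eval (s : ℂ)) * q.eval (s : ℂ)).re := by
      rw [mul_right_comm, mul_comm, Complex.re_ofReal_mul]
    have h5 := hmφ s hs
    have h6 := hφM s hs
    have hφ0 : 0 ≤ φ s := by linarith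
    rw [h4]
    calc _ ≤ φ s * ‖H s - g.eval (s : ℂ)‖ ^ 2
          + 2 * (φ s * ((H s - g.eval (s : ℂ)) * q.eval (s : ℂ)).re) := by gcongr
      _ ≤ φ s * ‖H s - p.eval (s : ℂ)‖ ^ 2 := by
          rw [h3]
          nlinarith [mul_nonneg hφ0 (sq_nonneg ‖g.eval (s : ℂ) - p.eval (s : ℂ)‖)]
      _ ≤ M * ε ^ 2 := mul_le_mul h6 h2 (by positivity) (by linarith)
  have hI : ∫ s in (-1 : ℝ)..1, (m * ‖H s - g.eval (s : ℂ)‖ ^ 2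
      + 2 * ((H s - g.eval (s : ℂ)) * φ s * q.eval (s : ℂ)).re)
      ≤ ∫ s in (-1 : ℝ)..1, M * ε ^ 2 := by
    apply intervalIntegral.integral_mono_on (by norm_num) _ (by simp) hpt
    exact intervalIntegrable_of_continuousOn_Icc
      ((continuousOn_const.mul hdn).add (continuousOn_const.mul hzrec))
  rw [intervalIntegral.integral_add
    ((intervalIntegrable_of_continuousOn_Icc hdn).const_mul _)
    ((intervalIntegrable_of_continuousOn_Icc hzrec).const_mul _),
    intervalIntegral.integral_const_mul, intervalIntegral.integral_const_mul, hzre] at hI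
  have hε2 : ε ^ 2 = A ^ 2 * (ρ⁻¹ ^ N) ^ 2 / (N + 1) := by
    rw [hε, mul_pow, div_pow, Real.sq_sqrt (by positivity)]
    ring
  rw [hε2] at hI
  simp only [intervalIntegral.integral_const, smul_eq_mul] at hI
  rw [← mul_le_mul_iff_right₀ hm]
  refine (le_of_eq (by ring)).trans (hI.trans (le_of_eq ?_))
  field_simp
  ring

/-- The constant in the error bound for weighted least squares approximation. -/
def projectionConst (ρ A L m M : ℝ) : ℝ :=
  (1 + 3 * A ^ 2 * ρ ^ 2) / (1 - ρ⁻¹) + L / m * (1 + M / m * A ^ 2)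

include hφ hm hmφ hφM in
/-- The error of a weighted least squares polynomial approximation decays at the rate `ρ⁻¹ ^ N`
if the best uniform approximation error is of order `ρ⁻¹ ^ N / √N`. -/
theorem norm_sub_weighted_projection_le (hL0 : 0 ≤ L)
    (hL : ∀ x ∈ Icc (-1 : ℝ) 1, ∀ t ∈ Icc (-1 : ℝ) 1, |φ x - φ t| ≤ L * |x - t|)
    {N : ℕ} {g : Polynomial ℂ} (hg : g.natDegree ≤ N)
    (horth : ∀ j ≤ N, ∫ s in (-1 : ℝ)..1, (H s - g.eval (s : ℂ)) * φ s * (s : ℂ) ^ j = 0)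
    {x : ℝ} (hx : x ∈ Icc (-1 : ℝ) 1) :
    ‖H x - g.eval (x : ℂ)‖ ≤ projectionConst ρ A L m M * ρ⁻¹ ^ N := by
  have hρ0 : 0 < ρ := by linarith
  have hd2 := integral_norm_sq_error_le hρ hH happ hφ hm hmφ hφM hg horth
  set d : ℝ → ℂ := fun s => H s - g.eval (s : ℂ) with hdd
  have hd : ContinuousOn d (Icc (-1 : ℝ) 1) := hH.sub (continuous_eval_ofReal g).continuousOn
  have hφc : ContinuousOn (fun s : ℝ => (φ s : ℂ)) (Icc (-1 : ℝ) 1) :=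
    Complex.continuous_ofReal.comp_continuousOn hφ
  set l : ℝ := ρ⁻¹ ^ N with hl
  have hl0 : 0 < l := by positivity
  have e1 : legendreSum H N x - g.eval (x : ℂ)
      = ∫ t in (-1 : ℝ)..1, (kernel N x t : ℂ) * d t := by
    simp_rw [hdd, mul_sub]
    rw [intervalIntegral.integral_sub
      (intervalIntegrable_of_continuousOn_Icc (continuousOn_kernel_mul hH _ _))
      (intervalIntegrable_of_continuousOn_Icc
        (continuousOn_kernel_mul (continuous_eval_ofReal g).continuousOn _ _)),
      integral_kernel_mul_eval hg, legendreSum]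
  -- The kernel is a polynomial of degree at most N in t, so the weighted error is orthogonal to it.
  -- Subtracting this zero from φ(x) times `e1` produces the factor φ(x) - φ(t).
  have e2 : ∫ t in (-1 : ℝ)..1, (kernel N x t : ℂ) * (d t * φ t) = 0 := by
    simp_rw [← eval_kernelPoly, mul_comm (Polynomial.eval _ (kernelPoly N x))]
    rw [integral_mul_eval (w := fun s => d s * φ s) (hd.mul hφc) (natDegree_kernelPoly_le N x)]
    refine Finset.sum_eq_zero fun j hj => ?_
    rw [horth j (by have := Finset.mem_range.1 hj; omega), mul_zero]
  have hx' := hmφ x hx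
  have hφx : 0 < φ x := by linarith
  have e3 : (φ x : ℂ) * (legendreSum H N x - g.eval (x : ℂ))
      = ∫ t in (-1 : ℝ)..1, (kernel N x t * (φ x - φ t) : ℝ) * d t := by
    rw [e1, ← sub_zero (_ * _), ← e2, ← intervalIntegral.integral_const_mul,
      ← intervalIntegral.integral_sub
      ((intervalIntegrable_of_continuousOn_Icc (continuousOn_kernel_mul hd _ _)).const_mul _)
      (intervalIntegrable_of_continuousOn_Icc
        (continuousOn_kernel_mul (H := fun t => d t * φ t) (hd.mul hφc) _ _))]
    refine intervalIntegral.integral_congr fun t _ => ?_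
    push_cast
    ring
  have hdn : ContinuousOn (fun s : ℝ => ‖d s‖ ^ 2) (Icc (-1 : ℝ) 1) := hd.norm.pow 2
  have hPP : ∀ k, IntervalIntegrable (fun t => P k t * P k t) volume (-1) 1 := fun k =>
    ((continuous_P _).mul (continuous_P _)).intervalIntegrable _ _
  have hdi := intervalIntegrable_of_continuousOn_Icc hdn
  have hpt : ∀ t ∈ Icc (-1 : ℝ) 1, ‖((kernel N x t * (φ x - φ t) : ℝ) : ℂ) * d t‖
      ≤ L * ((N + 1) / 4) * (l * (P N t * P N t) + l * (P (N + 1) t * P (N + 1) t)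
        + 2 * l⁻¹ * ‖d t‖ ^ 2) := by
    intro t ht
    rw [norm_mul, Complex.norm_real, Real.norm_eq_abs, abs_mul]
    -- The Lipschitz condition trades the weight difference for x - t, so that Christoffel–Darboux
    -- leaves a factor N times single Legendre polynomials in t.
    have h1 : |kernel N x t| * |φ x - φ t| ≤ L * |(x - t) * kernel N x t| := by
      rw [abs_mul]
      nlinarith [mul_le_mul_of_nonneg_left (hL x hx t ht) (abs_nonneg (kernel N x t))]
    have h2 : |(x - t) * kernel N x t| ≤ (N + 1) / 2 * (|P N t| + |P (N + 1) t|) := by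
      rw [christoffel_darboux, abs_mul, abs_of_nonneg (by positivity : (0 : ℝ) ≤ (N + 1) / 2)]
      gcongr
      refine (abs_sub _ _).trans ?_
      rw [abs_mul, abs_mul]
      gcongr
      · exact mul_le_of_le_one_left (abs_nonneg _) (abs_P_le_one _ hx)
      · exact mul_le_of_le_one_left (abs_nonneg _) (abs_P_le_one _ hx)
    have h3 := abs_mul_le_weighted (a := P N t) (b := ‖d t‖) hl0
    have h4 := abs_mul_le_weighted (a := P (N + 1) t) (b := ‖d t‖) hl0
    calc _ ≤ L * ((N + 1) / 2 * (|P N t| + |P (N + 1) t|)) * ‖d t‖ := by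
          refine mul_le_mul_of_nonneg_right (h1.trans ?_) (norm_nonneg _)
          gcongr
      _ = L * ((N + 1) / 2) * (|P N t| * ‖d t‖ + |P (N + 1) t| * ‖d t‖) := by ring
      _ ≤ L * ((N + 1) / 2) * ((l * (P N t * P N t) + l⁻¹ * ‖d t‖ ^ 2) / 2
          + (l * (P (N + 1) t * P (N + 1) t) + l⁻¹ * ‖d t‖ ^ 2) / 2) := by gcongr
      _ = _ := by ring
  have b : ‖∫ t in (-1 : ℝ)..1, ((kernel N x t * (φ x - φ t) : ℝ) : ℂ) * d t‖
      ≤ ∫ t in (-1 : ℝ)..1, L * ((N + 1) / 4) * (l * (P N t * P N t)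
        + l * (P (N + 1) t * P (N + 1) t) + 2 * l⁻¹ * ‖d t‖ ^ 2) := by
    apply intervalIntegral.norm_integral_le_of_norm_le (by norm_num)
    · exact Filter.Eventually.of_forall fun t ht => hpt t (Ioc_subset_Icc_self ht)
    · exact ((((hPP N).const_mul _).add ((hPP (N + 1)).const_mul _)).add
        (hdi.const_mul _)).const_mul _
  rw [intervalIntegral.integral_const_mul, intervalIntegral.integral_add
    (((hPP N).const_mul _).add ((hPP (N + 1)).const_mul _)) (hdi.const_mul _),
    intervalIntegral.integral_add ((hPP N).const_mul _) ((hPP (N + 1)).const_mul _),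
    intervalIntegral.integral_const_mul, intervalIntegral.integral_const_mul,
    intervalIntegral.integral_const_mul, integral_P_sq, integral_P_sq, ← e3, norm_mul,
    Complex.norm_real, Real.norm_eq_abs, abs_of_pos hφx] at b
  have hM : 0 ≤ M := by linarith [hφM x hx]
  -- All three integrals in the bracket carry a factor 1/(N+1), which cancels the N + 1 from
  -- Christoffel–Darboux.
  have b2 : L * ((N + 1) / 4) * (l * (2 / (2 * N + 1)) + l * (2 / (2 * (N + 1 : ℕ) + 1))
      + 2 * l⁻¹ * ∫ t in (-1 : ℝ)..1, ‖d t‖ ^ 2) ≤ L * (1 + M / m * A ^ 2) * l := by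
    have hN : (0 : ℝ) ≤ N := Nat.cast_nonneg N
    have h1 : (2 : ℝ) / (2 * N + 1) ≤ 2 / (N + 1) := by gcongr; linarith
    have h2 : (2 : ℝ) / (2 * (N + 1 : ℕ) + 1) ≤ 2 / (N + 1) := by
      gcongr; push_cast; linarith
    calc _ ≤ L * ((N + 1) / 4) * (l * (2 / (N + 1)) + l * (2 / (N + 1))
          + 2 * l⁻¹ * (2 * M / m * A ^ 2 * l ^ 2 / (N + 1))) := by gcongr
      _ = _ := by field_simp; ring
  have b3 : m * ‖legendreSum H N x - g.eval (x : ℂ)‖ ≤ L * (1 + M / m * A ^ 2) * l :=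
    (mul_le_mul_of_nonneg_right hx' (norm_nonneg _)).trans (b.trans b2)
  have b4 : ‖legendreSum H N x - g.eval (x : ℂ)‖ ≤ L / m * (1 + M / m * A ^ 2) * l := by
    rw [← mul_le_mul_iff_right₀ hm]
    refine b3.trans (le_of_eq ?_)
    field_simp
  calc ‖H x - g.eval (x : ℂ)‖
      = ‖(H x - legendreSum H N x) + (legendreSum H N x - g.eval (x : ℂ))‖ := by congr 1; ring
    _ ≤ _ := (norm_add_le _ _).trans (add_le_add (norm_sub_legendreSum_le hρ hH happ N hx) b4)
    _ = _ := by rw [projectionConst]; ring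

end Approximation

end

/-! ### Chebyshev coefficients of functions singular at the vertices of a Bernstein ellipse. -/

/-- The Joukowski map. -/
def joukowski (u : ℂ) : ℂ := (u + u⁻¹) / 2

lemma hasDerivAt_joukowski {u : ℂ} (hu : u ≠ 0) :
    HasDerivAt joukowski ((1 - (u ^ 2)⁻¹) / 2) u := by
  have := ((hasDerivAt_id u).add (hasDerivAt_inv hu)).div_const 2
  exact this.congr_deriv (by ring)

lemma joukowski_exp_mul_I (θ : ℝ) :
    joukowski (Complex.exp (θ * Complex.I)) = (Real.cos θ : ℂ) := by
  rw [joukowski, ← Complex.exp_neg, Complex.ofReal_cos, Complex.cos]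
  congr 3
  ring

lemma exists_joukowski_eq {s : ℝ} (hs : s ∈ Icc (-1 : ℝ) 1) :
    ∃ u : ℂ, ‖u‖ = 1 ∧ joukowski u = s :=
  ⟨Complex.exp (Real.arccos s * Complex.I), Complex.norm_exp_ofReal_mul_I _, by
    rw [joukowski_exp_mul_I, Real.cos_arccos hs.1 hs.2]⟩

/-- By symmetry the integral is four times that over [0, π/2], where Jordan's inequality sin θ ≥
2θ/π gives an integrand with an explicit antiderivative. It measures a singularity of order -3/2 on
a circle at relative distance ε from it. -/
lemma integral_rpow_abs_sin_le {ε : ℝ} (hε : 0 < ε) :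
    ∫ θ in (0 : ℝ)..2 * Real.pi, (ε + |Real.sin θ|) ^ (-(3 / 2) : ℝ)
      ≤ 4 * Real.pi * ε ^ (-(1 / 2) : ℝ) := by
  set h : ℝ → ℝ := fun θ => (ε + |Real.sin θ|) ^ (-(3 / 2) : ℝ) with hh
  have hpi := Real.pi_pos
  have hc : Continuous h := by
    refine Continuous.rpow_const (by fun_prop) fun θ => Or.inl ?_
    have := abs_nonneg (Real.sin θ)
    linarith
  have hper : Function.Periodic h Real.pi := fun θ => by simp [hh, Real.sin_add_pi]
  have hi : ∀ a b, IntervalIntegrable h volume a b := fun a b => hc.intervalIntegrable a b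
  have e1 : ∫ θ in (0 : ℝ)..2 * Real.pi, h θ = 2 * ∫ θ in (0 : ℝ)..Real.pi, h θ := by
    rw [← intervalIntegral.integral_add_adjacent_intervals (hi 0 Real.pi) (hi _ _)]
    have := hper.intervalIntegral_add_eq Real.pi 0
    rw [zero_add, ← two_mul] at this
    rw [this]; ring
  have e2 : ∫ θ in (0 : ℝ)..Real.pi, h θ = 2 * ∫ θ in (0 : ℝ)..Real.pi / 2, h θ := by
    rw [← intervalIntegral.integral_add_adjacent_intervals (hi 0 (Real.pi / 2)) (hi _ _)]
    have := intervalIntegral.integral_comp_sub_left h Real.pi (a := Real.pi / 2) (b := Real.pi)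
    rw [sub_self, sub_half] at this
    rw [← this]
    have : ∀ θ, h (Real.pi - θ) = h θ := fun θ => by simp [hh, Real.sin_pi_sub]
    simp_rw [this]
    exact (two_mul _).symm
  have hder : ∀ θ ∈ uIcc (0 : ℝ) (Real.pi / 2),
      HasDerivAt (fun θ => -Real.pi * (ε + 2 / Real.pi * θ) ^ (-(1 / 2) : ℝ))
        ((ε + 2 / Real.pi * θ) ^ (-(3 / 2) : ℝ)) θ := by
    intro θ hθ
    rw [uIcc_of_le (by positivity)] at hθ
    have hpos : 0 < ε + 2 / Real.pi * θ := by
      have := hθ.1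
      positivity
    have h1 : HasDerivAt (fun θ => ε + 2 / Real.pi * θ) (2 / Real.pi) θ := by
      simpa using ((hasDerivAt_id θ).const_mul (2 / Real.pi)).const_add ε
    refine ((h1.rpow_const (p := -(1 / 2)) (Or.inl hpos.ne')).const_mul
      (-Real.pi)).congr_deriv ?_
    rw [show (-(1 / 2) - 1 : ℝ) = -(3 / 2) by norm_num]
    field_simp
  have hcont : ContinuousOn (fun θ : ℝ => (ε + 2 / Real.pi * θ) ^ (-(3 / 2) : ℝ))
      (uIcc (0 : ℝ) (Real.pi / 2)) := by
    refine ContinuousOn.rpow_const (by fun_prop) fun θ hθ => Or.inl ?_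
    rw [uIcc_of_le (by positivity)] at hθ
    have := hθ.1
    positivity
  have e3 : ∫ θ in (0 : ℝ)..Real.pi / 2, h θ ≤ Real.pi * ε ^ (-(1 / 2) : ℝ) := by
    calc ∫ θ in (0 : ℝ)..Real.pi / 2, h θ
        ≤ ∫ θ in (0 : ℝ)..Real.pi / 2, (ε + 2 / Real.pi * θ) ^ (-(3 / 2) : ℝ) := by
          apply intervalIntegral.integral_mono_on (by positivity) (hi _ _)
            hcont.intervalIntegrable
          intro θ hθ
          have h0 := hθ.1
          have h1 := Real.mul_abs_le_abs_sin (x := θ) (by rw [abs_of_nonneg hθ.1]; exact hθ.2)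
          rw [abs_of_nonneg hθ.1] at h1
          apply Real.rpow_le_rpow_of_nonpos (by positivity) (by linarith) (by norm_num)
      _ = -Real.pi * (ε + 2 / Real.pi * (Real.pi / 2)) ^ (-(1 / 2) : ℝ)
          - -Real.pi * (ε + 2 / Real.pi * 0) ^ (-(1 / 2) : ℝ) :=
          intervalIntegral.integral_eq_sub_of_hasDerivAt hder hcont.intervalIntegrable
      _ ≤ Real.pi * ε ^ (-(1 / 2) : ℝ) := by
          have : 0 ≤ Real.pi * (ε + 2 / Real.pi * (Real.pi / 2)) ^ (-(1 / 2) : ℝ) := by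
            positivity
          rw [mul_zero, add_zero]
          linarith
  rw [e1, e2]
  linarith

section Chebyshev

variable {ρ σ : ℝ} (hρ : 1 < ρ) (hσ : σ * (ρ + ρ⁻¹) = 2)

include hρ hσ

/-- Because σ(ρ + 1/ρ) = 2, the left function factors as (σ²/4)(ρ² - u²)(1 - 1/(ρ²u²)). The last
factor stays away from 0 for |u| ≥ 1. The middle one vanishes only at u = ±ρ, and is at least ρ²ε
(radially) and ρ²|sin θ| (angularly), hence at least their mean. -/
lemma norm_one_sub_sq_joukowski_ge {ε : ℝ} (hε0 : 0 < ε) (hε1 : 1 ≤ ρ * (1 - ε)) (θ : ℝ) :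
    σ ^ 2 / 8 * (ρ ^ 2 - 1) * (ε + |Real.sin θ|)
      ≤ ‖1 - (σ * joukowski (circleMap 0 (ρ * (1 - ε)) θ)) ^ 2‖ := by
  have hρ0 : 0 < ρ := by linarith
  set r := ρ * (1 - ε) with hr
  have hr0 : 0 < r := by linarith
  have hrρ : r < ρ := by rw [hr]; nlinarith
  set u := circleMap 0 r θ with hu
  have hun : ‖u‖ = r := by simp [hu, abs_of_pos hr0]
  have hu0 : u ≠ 0 := by rw [← norm_pos_iff, hun]; exact hr0
  have hρc : (ρ : ℂ) ≠ 0 := by exact_mod_cast hρ0.ne'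
  have hσc : (σ : ℂ) * (ρ + (ρ : ℂ)⁻¹) = 2 := by exact_mod_cast hσ
  have e : 1 - (σ * joukowski u) ^ 2
      = ((σ ^ 2 / 4 : ℝ) : ℂ) * (((ρ ^ 2 : ℝ) : ℂ) - u ^ 2) * (1 - ((ρ : ℂ) ^ 2 * u ^ 2)⁻¹) := by
    have : (1 : ℂ) = (σ * (ρ + (ρ : ℂ)⁻¹) / 2) ^ 2 := by rw [hσc]; norm_num
    conv_lhs => rw [this]
    rw [joukowski]
    push_cast
    field_simp
    ring
  have h1 : (1 - (ρ ^ 2)⁻¹ : ℝ) ≤ ‖1 - ((ρ : ℂ) ^ 2 * u ^ 2)⁻¹‖ := by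
    have h2 := norm_sub_norm_le (1 : ℂ) ((ρ : ℂ) ^ 2 * u ^ 2)⁻¹
    rw [norm_one, norm_inv, norm_mul, norm_pow, norm_pow, hun, Complex.norm_real,
      Real.norm_eq_abs, abs_of_pos hρ0] at h2
    refine le_trans ?_ h2
    gcongr
    exact le_mul_of_one_le_right (by positivity) (one_le_pow₀ hε1)
  have h3 : ρ ^ 2 * ε ≤ ‖((ρ ^ 2 : ℝ) : ℂ) - u ^ 2‖ := by
    have h2 := norm_sub_norm_le ((ρ ^ 2 : ℝ) : ℂ) (u ^ 2)
    rw [norm_pow, hun, Complex.norm_real, Real.norm_eq_abs, abs_of_pos (by positivity)] at h2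
    refine le_trans ?_ h2
    have : ρ * ε = ρ - r := by rw [hr]; ring
    nlinarith
  have h4 : ρ ^ 2 * |Real.sin θ| ≤ ‖((ρ ^ 2 : ℝ) : ℂ) - u ^ 2‖ := by
    -- Rotating by e^(-iθ) turns ρ² - u² into ρ²e^(-iθ) - r²e^(iθ), whose imaginary part is -(ρ² +
    -- r²) sin θ.
    have h5 : ‖((ρ ^ 2 : ℝ) : ℂ) - u ^ 2‖
        = ‖(((ρ ^ 2 : ℝ) : ℂ) - u ^ 2) * Complex.exp (((-θ : ℝ) : ℂ) * Complex.I)‖ := by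
      rw [norm_mul, Complex.norm_exp_ofReal_mul_I, mul_one]
    have h6 : ((((ρ ^ 2 : ℝ) : ℂ) - u ^ 2) * Complex.exp (((-θ : ℝ) : ℂ) * Complex.I)).im
        = -((ρ ^ 2 + r ^ 2) * Real.sin θ) := by
      have : (((ρ ^ 2 : ℝ) : ℂ) - u ^ 2) * Complex.exp (((-θ : ℝ) : ℂ) * Complex.I)
          = ((ρ ^ 2 : ℝ) : ℂ) * Complex.exp (((-θ : ℝ) : ℂ) * Complex.I)
            - ((r ^ 2 : ℝ) : ℂ) * Complex.exp ((θ : ℂ) * Complex.I) := by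
        have h7 : Complex.exp (((-θ : ℝ) : ℂ) * Complex.I) * Complex.exp ((θ : ℂ) * Complex.I)
            = 1 := by
          rw [← Complex.exp_add]; simp
        rw [hu, circleMap, zero_add]
        push_cast at h7 ⊢
        linear_combination (-(r : ℂ) ^ 2 * Complex.exp ((θ : ℂ) * Complex.I)) * h7
      rw [this, Complex.sub_im, Complex.im_ofReal_mul, Complex.im_ofReal_mul,
        Complex.exp_ofReal_mul_I_im, Complex.exp_ofReal_mul_I_im, Real.sin_neg]
      ring
    rw [h5]
    refine le_trans ?_ (Complex.abs_im_le_norm _)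
    rw [h6, abs_neg, abs_mul, abs_of_pos (by positivity : 0 < ρ ^ 2 + r ^ 2)]
    gcongr
    nlinarith
  rw [e, norm_mul, norm_mul, Complex.norm_real, Real.norm_eq_abs,
    abs_of_nonneg (by positivity : 0 ≤ σ ^ 2 / 4)]
  have h7 : 0 ≤ 1 - (ρ ^ 2)⁻¹ := by
    rw [sub_nonneg]
    exact inv_le_one_of_one_le₀ (one_le_pow₀ hρ.le)
  have h8 : ρ ^ 2 * (ε + |Real.sin θ|) / 2 ≤ ‖((ρ ^ 2 : ℝ) : ℂ) - u ^ 2‖ := by linarith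
  calc _ = σ ^ 2 / 4 * (ρ ^ 2 * (ε + |Real.sin θ|) / 2) * (1 - (ρ ^ 2)⁻¹) := by
        field_simp; ring
    _ ≤ _ := by gcongr

variable {H : ℂ → ℂ} {B : ℝ}
  (hd : ∀ u : ℂ, 1 ≤ ‖u‖ → ‖u‖ < ρ → DifferentiableAt ℂ H (joukowski u))
  (hB0 : 0 ≤ B)
  (hB : ∀ u : ℂ, 1 ≤ ‖u‖ → ‖u‖ < ρ →
    ‖deriv H (joukowski u)‖ ≤ B * ‖1 - (σ * joukowski u) ^ 2‖ ^ (-(3 / 2) : ℝ))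

include hd hB0 hB

-- Cauchy's theorem moves the contour from radius 1 to radius r; integration by parts there gains
-- the factor k and replaces H by its derivative.
omit hρ hσ hB0 hB in
lemma circleIntegral_eq_of_one_lt_radius {r : ℝ} (hr1 : 1 < r) (hrρ : r < ρ) {k : ℕ}
    (hk : 1 ≤ k) :
    (k : ℂ) * ∮ u in C(0, 1), H (joukowski u) * (u ^ (k + 1))⁻¹
      = ∮ u in C(0, r), deriv H (joukowski u) * ((1 - (u ^ 2)⁻¹) / 2) * (u ^ k)⁻¹ := by
  have hdiff : ∀ u : ℂ, 1 ≤ ‖u‖ → ‖u‖ < ρ → HasDerivAt (fun u => H (joukowski u))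
      (deriv H (joukowski u) * ((1 - (u ^ 2)⁻¹) / 2)) u := by
    intro u h1 h2
    have hu0 : u ≠ 0 := by rw [← norm_pos_iff]; linarith
    exact (hd u h1 h2).hasDerivAt.comp u (hasDerivAt_joukowski hu0)
  have hdiff2 : ∀ u : ℂ, 1 ≤ ‖u‖ → ‖u‖ < ρ →
      DifferentiableAt ℂ (fun u => H (joukowski u) * (u ^ (k + 1))⁻¹) u := by
    intro u h1 h2
    have hu0 : u ≠ 0 := by rw [← norm_pos_iff]; linarith
    exact (hdiff u h1 h2).differentiableAt.mul
      ((differentiableAt_id.pow _).inv (pow_ne_zero _ hu0))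
  rw [← Complex.circleIntegral_eq_of_differentiable_on_annulus_off_countable one_pos hr1.le
    countable_empty (f := fun u => H (joukowski u) * (u ^ (k + 1))⁻¹)]
  rotate_left
  · rintro u ⟨hu1, hu2⟩
    simp only [mem_closedBall_zero_iff, mem_ball_zero_iff, not_lt] at hu1 hu2
    exact (hdiff2 u hu2 (by linarith)).continuousAt.continuousWithinAt
  · rintro u ⟨⟨hu1, hu2⟩, -⟩
    simp only [mem_closedBall_zero_iff, mem_ball_zero_iff, not_le] at hu1 hu2
    exact hdiff2 u hu2.le (by linarith)
  have hsph : ∀ u ∈ Metric.sphere (0 : ℂ) r, 1 ≤ ‖u‖ ∧ ‖u‖ < ρ := by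
    intro u hu
    rw [mem_sphere_zero_iff_norm] at hu
    exact ⟨by linarith, by linarith⟩
  have hzero : (∮ u in C(0, r), (deriv H (joukowski u) * ((1 - (u ^ 2)⁻¹) / 2) * (u ^ k)⁻¹
      - k * (H (joukowski u) * (u ^ (k + 1))⁻¹))) = 0 := by
    apply circleIntegral.integral_eq_zero_of_hasDerivWithinAt (by linarith)
      (f := fun u => H (joukowski u) * (u ^ k)⁻¹)
    intro u hu
    obtain ⟨h1, h2⟩ := hsph u hu
    have hu0 : u ≠ 0 := by rw [← norm_pos_iff]; linarith
    refine (((hdiff u h1 h2).mul ((hasDerivAt_pow k u).inv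
      (pow_ne_zero _ hu0))).congr_deriv ?_).hasDerivWithinAt
    obtain ⟨j, rfl⟩ : ∃ j, k = j + 1 := ⟨k - 1, by omega⟩
    simp only [Nat.add_sub_cancel, Pi.inv_apply]
    field_simp
    ring
  have hc1 : CircleIntegrable (fun u => k * (H (joukowski u) * (u ^ (k + 1))⁻¹)) 0 r := by
    apply ContinuousOn.circleIntegrable (by linarith)
    intro u hu
    obtain ⟨h1, h2⟩ := hsph u hu
    exact ((hdiff2 u h1 h2).continuousAt.const_mul _).continuousWithinAt
  have hc2 : CircleIntegrable
      (fun u => deriv H (joukowski u) * ((1 - (u ^ 2)⁻¹) / 2) * (u ^ k)⁻¹) 0 r := by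
    apply ContinuousOn.circleIntegrable (by linarith)
    -- Continuity of the integrand is obtained from the derivative of the composite H ∘ J, which is
    -- holomorphic on this open annulus. The strict inequality 1 < r puts the circle inside it.
    have hopen : IsOpen {u : ℂ | 1 < ‖u‖ ∧ ‖u‖ < ρ} :=
      (isOpen_lt continuous_const continuous_norm).inter
        (isOpen_lt continuous_norm continuous_const)
    have hG : DifferentiableOn ℂ (fun u => H (joukowski u)) {u : ℂ | 1 < ‖u‖ ∧ ‖u‖ < ρ} :=
      fun u hu => (hdiff u hu.1.le hu.2).differentiableAt.differentiableWithinAt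
    have hG' := (hG.deriv hopen).continuousOn
    intro u hu
    have hn := mem_sphere_zero_iff_norm.1 hu
    have hu0 : u ≠ 0 := by rw [← norm_pos_iff]; linarith
    have hmem : u ∈ {u : ℂ | 1 < ‖u‖ ∧ ‖u‖ < ρ} := ⟨by linarith, by linarith⟩
    have h1 := (hG'.continuousAt (hopen.mem_nhds hmem)).mul
      ((continuousAt_id.pow k).inv₀ (pow_ne_zero _ hu0))
    refine (h1.congr ?_).continuousWithinAt
    filter_upwards [hopen.mem_nhds hmem] with v hv
    simp only [Pi.mul_apply, Pi.inv_apply, Pi.pow_apply, id]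
    rw [(hdiff v hv.1.le hv.2).deriv]
  rw [circleIntegral.integral_sub hc2 hc1, circleIntegral.integral_const_mul, sub_eq_zero] at hzero
  exact hzero.symm

/-- The constant in the decay estimate for the Chebyshev coefficients. -/
def chebyshevConst (ρ σ B : ℝ) : ℝ :=
  4 * ρ * (B * (σ ^ 2 / 8 * (ρ ^ 2 - 1)) ^ (-(3 / 2) : ℝ)) * ((1 - ρ⁻¹) / 2) ^ (-(1 / 2) : ℝ)

/-- The circle has radius r = ρ(1 - δ/k). Then r^(-k) loses only a factor 2 against ρ^(-k), the
singular integral costs (δ/k)^(-1/2), of order √k, and the integration by parts gains 1/k;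
altogether 1/√k. -/
lemma norm_circleIntegral_joukowski_le {k : ℕ} (hk : 1 ≤ k) :
    ‖∮ u in C(0, 1), H (joukowski u) * (u ^ (k + 1))⁻¹‖
      ≤ 2 * Real.pi * (chebyshevConst ρ σ B / √k * ρ⁻¹ ^ k) := by
  have hρ0 : 0 < ρ := by linarith
  have hρi : ρ⁻¹ < 1 := inv_lt_one_of_one_lt₀ hρ
  have hρi0 : 0 < ρ⁻¹ := by positivity
  have hk0 : (1 : ℝ) ≤ k := by exact_mod_cast hk
  have hkp : (0 : ℝ) < k := by linarith
  -- With this δ the radius ρ(1 - δ/k) is at least (ρ + 1)/2 > 1 for every k ≥ 1, and δ ≤ 1/2 makes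
  -- Bernoulli's inequality yield (1 - δ/k)^k ≥ 1/2.
  set δ : ℝ := (1 - ρ⁻¹) / 2 with hδ
  have hδ0 : 0 < δ := by rw [hδ]; linarith
  have hδ1 : δ ≤ 1 / 2 := by rw [hδ]; linarith
  set ε : ℝ := δ / k with hε
  have hε0 : 0 < ε := by positivity
  have hεδ : ε ≤ δ := div_le_self hδ0.le hk0
  have hr1 : 1 < ρ * (1 - ε) := by
    have h1 : ρ * (1 - δ) ≤ ρ * (1 - ε) := by gcongr
    have h2 : ρ * (1 - δ) = (ρ + 1) / 2 := by rw [hδ]; field_simp; ring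
    linarith
  have hrρ : ρ * (1 - ε) < ρ := by nlinarith
  set r := ρ * (1 - ε) with hr
  have hr0 : 0 < r := by linarith
  have hpow : (r ^ k)⁻¹ ≤ 2 * ρ⁻¹ ^ k := by
    have h1 : 1 / 2 ≤ (1 - ε) ^ k := by
      have := one_add_mul_le_pow (a := -ε) (by linarith) k
      have h2 : (k : ℝ) * -ε = -δ := by rw [hε]; field_simp
      rw [h2] at this
      rw [sub_eq_add_neg]
      linarith
    rw [hr, mul_pow, mul_inv, inv_pow, mul_comm]
    gcongr
    rw [inv_le_comm₀ (by linarith) (by norm_num)]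
    linarith
  set κ := σ ^ 2 / 8 * (ρ ^ 2 - 1) with hκ
  have hσ0 : σ ≠ 0 := by rintro rfl; simp at hσ
  have hκ0 : 0 < κ := by
    have : 0 < ρ ^ 2 - 1 := by nlinarith
    positivity
  have hint : ‖∮ u in C(0, r), deriv H (joukowski u) * ((1 - (u ^ 2)⁻¹) / 2) * (u ^ k)⁻¹‖
      ≤ ∫ θ in (0 : ℝ)..2 * Real.pi, ρ * (B * κ ^ (-(3 / 2) : ℝ)) * (2 * ρ⁻¹ ^ k)
        * (ε + |Real.sin θ|) ^ (-(3 / 2) : ℝ) := by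
    rw [circleIntegral]
    apply intervalIntegral.norm_integral_le_of_norm_le Real.two_pi_pos.le
    · refine Filter.Eventually.of_forall fun θ _ => ?_
      have hun : ‖circleMap 0 r θ‖ = r := by simp [abs_of_pos hr0]
      have h1 := hB (circleMap 0 r θ) (by rw [hun]; exact hr1.le) (by rw [hun]; exact hrρ)
      have h2 := norm_one_sub_sq_joukowski_ge hρ hσ hε0 hr1.le θ
      have hX : 0 < ε + |Real.sin θ| := by positivity
      have h3 : ‖deriv H (joukowski (circleMap 0 r θ))‖
          ≤ B * κ ^ (-(3 / 2) : ℝ) * (ε + |Real.sin θ|) ^ (-(3 / 2) : ℝ) := by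
        refine h1.trans ?_
        rw [mul_assoc, ← Real.mul_rpow hκ0.le hX.le]
        exact mul_le_mul_of_nonneg_left
          (Real.rpow_le_rpow_of_nonpos (by positivity) h2 (by norm_num)) hB0
      have h4 : ‖(1 - (circleMap 0 r θ ^ 2)⁻¹) / 2‖ ≤ 1 := by
        rw [norm_div, Complex.norm_two, div_le_iff₀ (by norm_num)]
        refine (norm_sub_le _ _).trans ?_
        rw [norm_one, norm_inv, norm_pow, hun]
        have : (r ^ 2)⁻¹ ≤ 1 := inv_le_one_of_one_le₀ (one_le_pow₀ hr1.le)
        linarith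
      rw [norm_smul, norm_mul, norm_mul, norm_inv, norm_pow, hun, deriv_circleMap, norm_mul,
        hun, Complex.norm_I, mul_one]
      calc _ ≤ ρ * (B * κ ^ (-(3 / 2) : ℝ) * (ε + |Real.sin θ|) ^ (-(3 / 2) : ℝ) * 1
            * (2 * ρ⁻¹ ^ k)) := by gcongr
        _ = _ := by ring
    · apply Continuous.intervalIntegrable
      refine continuous_const.mul (Continuous.rpow_const (by fun_prop) fun θ => Or.inl ?_)
      have := abs_nonneg (Real.sin θ)
      linarith
  rw [← circleIntegral_eq_of_one_lt_radius hd hr1 hrρ hk,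
    intervalIntegral.integral_const_mul, norm_mul, Complex.norm_natCast] at hint
  have h5 : (k : ℝ) * ‖∮ u in C(0, 1), H (joukowski u) * (u ^ (k + 1))⁻¹‖
      ≤ ρ * (B * κ ^ (-(3 / 2) : ℝ)) * (2 * ρ⁻¹ ^ k) * (4 * Real.pi * ε ^ (-(1 / 2) : ℝ)) :=
    hint.trans (mul_le_mul_of_nonneg_left (integral_rpow_abs_sin_le hε0) (by positivity))
  have h6 : ε ^ (-(1 / 2) : ℝ) = δ ^ (-(1 / 2) : ℝ) * √k := by
    rw [hε, Real.div_rpow hδ0.le hkp.le, Real.rpow_neg hkp.le, ← Real.sqrt_eq_rpow, div_inv_eq_mul]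
  rw [← mul_le_mul_iff_right₀ hkp]
  refine h5.trans (le_of_eq ?_)
  rw [h6, chebyshevConst, ← hκ, ← hδ]
  have h7 : √(k : ℝ) ≠ 0 := by positivity
  field_simp
  rw [Real.sq_sqrt hkp.le]

end Chebyshev

section Chebyshev

variable {ρ σ : ℝ} (hρ : 1 < ρ) (hσ : σ * (ρ + ρ⁻¹) = 2) {H : ℂ → ℂ} {B : ℝ}
  (hd : ∀ u : ℂ, 1 ≤ ‖u‖ → ‖u‖ < ρ → DifferentiableAt ℂ H (joukowski u))
  (hB0 : 0 ≤ B)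
  (hB : ∀ u : ℂ, 1 ≤ ‖u‖ → ‖u‖ < ρ →
    ‖deriv H (joukowski u)‖ ≤ B * ‖1 - (σ * joukowski u) ^ 2‖ ^ (-(3 / 2) : ℝ))

include hρ hσ hd hB0 hB

/-- The coefficients are the Fourier coefficients of the even function θ ↦ H(cos θ). Pairing the
indices n and -n counts n = 0 twice, whence the extra c 0 on the right. -/
lemma exists_hasSum_chebyshev : ∃ c : ℕ → ℂ,
    (∀ n, 1 ≤ n → ‖c n‖ ≤ chebyshevConst ρ σ B / √n * ρ⁻¹ ^ n) ∧
    ∀ θ : ℝ, HasSum (fun n : ℕ => 2 * c n * Complex.cos (n * θ))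
      (H (Real.cos θ : ℂ) + c 0) := by
  have hρ0 : 0 < ρ := by linarith
  have : Fact (0 < 2 * Real.pi) := ⟨Real.two_pi_pos⟩
  let f : C(AddCircle (2 * Real.pi), ℂ) :=
    ⟨fun x => H (joukowski (AddCircle.toCircle x)), by
      have h1 : Continuous fun x : AddCircle (2 * Real.pi) => (AddCircle.toCircle x : ℂ) :=
        continuous_subtype_val.comp AddCircle.continuous_toCircle
      refine continuous_iff_continuousAt.2 fun x => ?_
      have hn : ‖(AddCircle.toCircle x : ℂ)‖ = 1 := Circle.norm_coe _
      have h2 := (hd (AddCircle.toCircle x) hn.ge (by rw [hn]; exact hρ)).continuousAt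
      have h3 := (hasDerivAt_joukowski (u := (AddCircle.toCircle x : ℂ))
        (Circle.coe_ne_zero _)).continuousAt
      exact ContinuousAt.comp (f := fun x : AddCircle (2 * Real.pi) =>
        joukowski (AddCircle.toCircle x)) h2 (ContinuousAt.comp (f := fun x :
          AddCircle (2 * Real.pi) => (AddCircle.toCircle x : ℂ)) h3 h1.continuousAt)⟩
  have hf : ∀ θ : ℝ, f (θ : AddCircle (2 * Real.pi)) = H (Real.cos θ : ℂ) := by
    intro θ
    change H (joukowski (AddCircle.toCircle (θ : AddCircle (2 * Real.pi)))) = _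
    rw [AddCircle.toCircle_apply_mk, Circle.coe_exp, div_self Real.two_pi_pos.ne', one_mul,
      joukowski_exp_mul_I]
  have hsymm : ∀ n : ℤ, fourierCoeff f (-n) = fourierCoeff f n := by
    intro n
    rw [fourierCoeff, fourierCoeff, ← integral_neg_eq_self]
    refine integral_congr_ae (Filter.Eventually.of_forall fun x => ?_)
    induction x using QuotientAddGroup.induction_on with
    | H θ =>
      have h1 : f (-(θ : AddCircle (2 * Real.pi))) = f (θ : AddCircle (2 * Real.pi)) := by
        rw [← AddCircle.coe_neg, hf, hf, Real.cos_neg]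
      have h2 : (fourier (- -n)) (-(θ : AddCircle (2 * Real.pi)))
          = (fourier (-n)) (θ : AddCircle (2 * Real.pi)) := by
        rw [← AddCircle.coe_neg, fourier_coe_apply, fourier_coe_apply]
        congr 2
        push_cast
        ring
      beta_reduce
      rw [h2]
      exact congrArg _ h1
  have hcoef : ∀ k : ℕ, fourierCoeff f (k : ℤ) = (2 * Real.pi * Complex.I)⁻¹ *
      ∮ u in C(0, 1), H (joukowski u) * (u ^ (k + 1))⁻¹ := by
    intro k
    rw [fourierCoeff_eq_intervalIntegral f (k : ℤ) 0, circleIntegral, zero_add, mul_inv, mul_assoc,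
      ← intervalIntegral.integral_const_mul]
    rw [Complex.real_smul]
    congr 1
    · push_cast; ring
    · refine intervalIntegral.integral_congr fun θ _ => ?_
      have h1 : circleMap 0 1 θ = Complex.exp (θ * Complex.I) := by simp [circleMap]
      rw [hf, fourier_coe_apply, deriv_circleMap, h1, joukowski_exp_mul_I, smul_eq_mul,
        smul_eq_mul, ← Complex.exp_nat_mul, ← Complex.exp_neg]
      have h2 : Complex.exp (2 * Real.pi * Complex.I * ((-(k : ℤ) : ℤ) : ℂ) * θ
          / ((2 * Real.pi : ℝ) : ℂ))
          = Complex.exp (θ * Complex.I) * Complex.exp (-(((k + 1 : ℕ) : ℂ) * (θ * Complex.I))) := by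
        rw [← Complex.exp_add]
        congr 1
        have : (Real.pi : ℂ) ≠ 0 := by exact_mod_cast Real.pi_ne_zero
        push_cast
        field_simp
        ring
      rw [h2]
      linear_combination -(Complex.exp (θ * Complex.I)
        * Complex.exp (-(((k + 1 : ℕ) : ℂ) * (θ * Complex.I))) * H (Real.cos θ : ℂ))
        * (inv_mul_cancel₀ Complex.I_ne_zero)
  have hbound : ∀ n : ℕ, 1 ≤ n →
      ‖fourierCoeff f (n : ℤ)‖ ≤ chebyshevConst ρ σ B / √n * ρ⁻¹ ^ n := by
    intro n hn
    have h1 := norm_circleIntegral_joukowski_le hρ hσ hd hB0 hB hn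
    rw [hcoef, norm_mul, norm_inv, norm_mul, norm_mul, Complex.norm_I, Complex.norm_two,
      Complex.norm_real, Real.norm_eq_abs, abs_of_pos Real.pi_pos, mul_one,
      inv_mul_le_iff₀ Real.two_pi_pos]
    exact h1
  have hK : 0 ≤ chebyshevConst ρ σ B := by
    have := (norm_nonneg _).trans (hbound 1 le_rfl)
    simp only [Nat.cast_one, Real.sqrt_one, div_one, pow_one] at this
    exact nonneg_of_mul_nonneg_left this (by positivity)
  have hsumN : Summable fun n : ℕ => fourierCoeff f (n : ℤ) := by
    rw [← summable_nat_add_iff 1]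
    refine Summable.of_norm_bounded (g := fun n : ℕ => chebyshevConst ρ σ B * ρ⁻¹ ^ (n + 1))
      ?_ fun n => ?_
    · exact ((summable_nat_add_iff 1).2 (summable_geometric_of_lt_one (by positivity)
        (inv_lt_one_of_one_lt₀ hρ))).mul_left _
    · refine (hbound (n + 1) (by omega)).trans ?_
      gcongr
      apply div_le_self hK
      rw [Real.one_le_sqrt]
      push_cast
      linarith [(Nat.cast_nonneg n : (0 : ℝ) ≤ n)]
  have hsum : Summable (fourierCoeff f) := by
    refine Summable.of_nat_of_neg hsumN ?_
    simpa only [hsymm] using hsumN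
  refine ⟨fun n => fourierCoeff f (n : ℤ), hbound, fun θ => ?_⟩
  have h1 := (has_pointwise_sum_fourier_series_of_summable hsum
    (θ : AddCircle (2 * Real.pi))).nat_add_neg
  have hz : (fourier 0 : C(AddCircle (2 * Real.pi), ℂ)) (θ : AddCircle (2 * Real.pi)) = 1 :=
    fourier_zero
  rw [hf, hz, smul_eq_mul, mul_one] at h1
  convert h1 using 2 with n
  rotate_left
  · simp
  rw [hsymm, fourier_coe_apply, fourier_coe_apply, smul_eq_mul, smul_eq_mul, ← mul_add,
    Complex.cos]
  have hpi : (Real.pi : ℂ) ≠ 0 := by exact_mod_cast Real.pi_ne_zero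
  have e1 : 2 * Real.pi * Complex.I * ((n : ℤ) : ℂ) * θ / ((2 * Real.pi : ℝ) : ℂ)
      = n * θ * Complex.I := by
    push_cast; field_simp
  have e2 : 2 * Real.pi * Complex.I * ((-(n : ℤ) : ℤ) : ℂ) * θ / ((2 * Real.pi : ℝ) : ℂ)
      = -(n * θ) * Complex.I := by
    push_cast; field_simp
  rw [e1, e2]
  ring

/-- A function that is holomorphic inside a Bernstein ellipse and whose derivative is of order
`-3/2` at its two vertices has polynomial approximants of accuracy `ρ⁻¹ ^ N / √N` on `[-1,1]`. -/
theorem exists_polynomial_approx : ∃ A : ℝ, ∀ N : ℕ, ∃ p : Polynomial ℂ, p.natDegree ≤ N ∧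
    ∀ s ∈ Icc (-1 : ℝ) 1, ‖H s - p.eval (s : ℂ)‖ ≤ A / √(N + 1) * ρ⁻¹ ^ N := by
  obtain ⟨c, hc, hsum⟩ := exists_hasSum_chebyshev hρ hσ hd hB0 hB
  have hρ0 : 0 < ρ := by linarith
  have hρi : ρ⁻¹ < 1 := inv_lt_one_of_one_lt₀ hρ
  have hK : 0 ≤ chebyshevConst ρ σ B := by
    have := (norm_nonneg _).trans (hc 1 le_rfl)
    simp only [Nat.cast_one, Real.sqrt_one, div_one, pow_one] at this
    exact nonneg_of_mul_nonneg_left this (by positivity)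
  -- The tail beyond N is dominated by a geometric series starting at ρ^(-(N+1)), with 1/√n replaced
  -- by its largest value 1/√(N+1).
  refine ⟨2 * chebyshevConst ρ σ B * ρ⁻¹ * (1 - ρ⁻¹)⁻¹, fun N => ?_⟩
  refine ⟨(∑ n ∈ Finset.range (N + 1), Polynomial.C (2 * c n) * Polynomial.Chebyshev.T ℂ n)
    - Polynomial.C (c 0), ?_, fun s hs => ?_⟩
  · rw [Polynomial.natDegree_sub_C]
    refine (Polynomial.natDegree_sum_le_of_forall_le _ _ fun k hk => ?_)
    refine (Polynomial.natDegree_C_mul_le _ _).trans ?_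
    rw [Polynomial.Chebyshev.natDegree_T]
    have := Finset.mem_range.1 hk
    simp only [Int.natAbs_natCast]
    omega
  · have h1 := (hasSum_nat_add_iff' (N + 1)).2 (hsum (Real.arccos s))
    rw [Real.cos_arccos hs.1 hs.2] at h1
    have h2 : ∀ n : ℕ, (Polynomial.Chebyshev.T ℂ n).eval (s : ℂ)
        = Complex.cos (n * (Real.arccos s : ℝ)) := by
      intro n
      have := Polynomial.Chebyshev.T_complex_cos (Real.arccos s : ℂ) n
      rw [← Complex.ofReal_cos, Real.cos_arccos hs.1 hs.2] at this
      simpa using this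
    have h3 : H s - ((∑ n ∈ Finset.range (N + 1), Polynomial.C (2 * c n)
        * Polynomial.Chebyshev.T ℂ n) - Polynomial.C (c 0)).eval (s : ℂ)
        = H s + c 0 - ∑ n ∈ Finset.range (N + 1), 2 * c n
          * Complex.cos (n * (Real.arccos s : ℝ)) := by
      simp only [Polynomial.eval_sub, Polynomial.eval_finsetSum, Polynomial.eval_mul,
        Polynomial.eval_C, h2]
      ring
    have hg : HasSum (fun n : ℕ => 2 * chebyshevConst ρ σ B / √(N + 1) * ρ⁻¹ ^ (N + 1) * ρ⁻¹ ^ n)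
        (2 * chebyshevConst ρ σ B / √(N + 1) * ρ⁻¹ ^ (N + 1) * (1 - ρ⁻¹)⁻¹) :=
      (hasSum_geometric_of_lt_one (by positivity) hρi).mul_left _
    rw [h3, ← h1.tsum_eq]
    refine (tsum_of_norm_bounded hg fun n => ?_).trans (le_of_eq (by ring))
    have h4 : ‖Complex.cos ((n + (N + 1) : ℕ) * (Real.arccos s : ℝ))‖ ≤ 1 := by
      rw [← Complex.ofReal_natCast, ← Complex.ofReal_mul, ← Complex.ofReal_cos,
        Complex.norm_real]
      exact Real.abs_cos_le_one _
    rw [norm_mul, norm_mul, Complex.norm_two]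
    calc _ ≤ 2 * (chebyshevConst ρ σ B / √((n + (N + 1) : ℕ) : ℝ) * ρ⁻¹ ^ (n + (N + 1))) * 1 := by
          gcongr
          exact hc _ (by omega)
      _ ≤ 2 * (chebyshevConst ρ σ B / √(N + 1) * ρ⁻¹ ^ (n + (N + 1))) * 1 := by
          gcongr
          push_cast
          linarith [(Nat.cast_nonneg n : (0 : ℝ) ≤ n)]
      _ = _ := by ring

end Chebyshev

/-! ### The inverse sine on the unit disc. -/

/-- The principal branch of `√(1 - z²)`. -/
def cosArcsin (z : ℂ) : ℂ := (1 - z ^ 2) ^ (1 / 2 : ℂ)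

/-- The principal branch of the inverse sine on the unit disc. -/
def arcsin (z : ℂ) : ℂ := -Complex.I * Complex.log (Complex.I * z + cosArcsin z)

section Arcsin

variable {z : ℂ} (hz : ‖z‖ < 1)
include hz

lemma one_sub_sq_re_pos : 0 < (1 - z ^ 2).re := by
  have h1 : ‖z ^ 2‖ < 1 := by rw [norm_pow]; exact pow_lt_one₀ (norm_nonneg _) hz two_ne_zero
  have h2 := (Complex.re_le_norm (z ^ 2)).trans_lt h1
  simpa using h2

lemma one_sub_sq_ne_zero : 1 - z ^ 2 ≠ 0 := fun h => by
  have := one_sub_sq_re_pos hz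
  rw [h] at this
  simp at this

omit hz in
lemma cosArcsin_sq : cosArcsin z ^ 2 = 1 - z ^ 2 := by
  rw [cosArcsin, ← Complex.cpow_nat_mul]
  simp

lemma cosArcsin_ne_zero : cosArcsin z ≠ 0 := fun h => by
  have := cosArcsin_sq (z := z)
  rw [h] at this
  exact one_sub_sq_ne_zero hz (by rw [← this]; ring)

/-- The square root halves an argument lying strictly between -π and π. -/
lemma cosArcsin_re_pos : 0 < (cosArcsin z).re := by
  rw [cosArcsin, Complex.cpow_def_of_ne_zero (one_sub_sq_ne_zero hz), Complex.exp_re]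
  apply mul_pos (Real.exp_pos _)
  have h1 : (Complex.log (1 - z ^ 2) * (1 / 2 : ℂ)).im = (1 - z ^ 2).arg / 2 := by
    rw [show (1 / 2 : ℂ) = ((1 / 2 : ℝ) : ℂ) by norm_num, Complex.im_mul_ofReal,
      Complex.log_im]
    ring
  rw [h1]
  have h2 := Complex.neg_pi_lt_arg (1 - z ^ 2)
  have h3 := (Complex.mem_slitPlane_iff_arg.1
    (Or.inl (one_sub_sq_re_pos hz) : 1 - z ^ 2 ∈ Complex.slitPlane)).1
  have h4 := lt_of_le_of_ne (Complex.arg_le_pi (1 - z ^ 2)) h3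
  exact Real.cos_pos_of_mem_Ioo ⟨by linarith, by linarith⟩

omit hz in
lemma mul_cosArcsin_sub : (Complex.I * z + cosArcsin z) * (cosArcsin z - Complex.I * z) = 1 := by
  have h1 := cosArcsin_sq (z := z)
  linear_combination h1 - z ^ 2 * Complex.I_sq

/-- This number and its inverse have real parts of the same sign, and they add up to twice
`cosArcsin z`. It keeps the logarithm in `arcsin` off its branch cut and confines the real part of
`arcsin` to [-π/2, π/2]. -/
lemma re_I_mul_add_cosArcsin_pos : 0 < (Complex.I * z + cosArcsin z).re := by
  have h1 := mul_cosArcsin_sub (z := z)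
  set p := Complex.I * z + cosArcsin z with hp
  have hp0 : p ≠ 0 := left_ne_zero_of_mul_eq_one h1
  have h2 : cosArcsin z - Complex.I * z = p⁻¹ := eq_inv_of_mul_eq_one_right h1
  have h3 : p.re + p.re / Complex.normSq p = 2 * (cosArcsin z).re := by
    rw [← Complex.inv_re, ← h2, hp]
    simp only [Complex.add_re, Complex.sub_re]
    ring
  have h4 := cosArcsin_re_pos hz
  have h5 : 0 < Complex.normSq p := Complex.normSq_pos.2 hp0
  by_contra! h
  have : p.re / Complex.normSq p ≤ 0 := div_nonpos_of_nonpos_of_nonneg h h5.le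
  linarith

lemma hasDerivAt_cosArcsin : HasDerivAt cosArcsin (-z / cosArcsin z) z := by
  have h1 : HasDerivAt (fun z : ℂ => 1 - z ^ 2) (-(2 * z)) z := by
    simpa using ((hasDerivAt_id z).pow 2).const_sub 1
  have h2 := h1.cpow_const (c := 1 / 2) (Or.inl (one_sub_sq_re_pos hz))
  refine h2.congr_deriv ?_
  have h3 : (1 - z ^ 2) ^ (1 / 2 - 1 : ℂ) = (cosArcsin z)⁻¹ := by
    rw [cosArcsin, ← Complex.cpow_neg]
    norm_num
  rw [h3]
  ring

lemma hasDerivAt_arcsin : HasDerivAt arcsin (cosArcsin z)⁻¹ z := by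
  have h1 : HasDerivAt (fun z => Complex.I * z + cosArcsin z)
      (Complex.I + -z / cosArcsin z) z := by
    have h0 := ((hasDerivAt_id z).const_mul Complex.I).add (hasDerivAt_cosArcsin hz)
    rw [mul_one] at h0
    exact h0
  have h2 := (h1.clog (Or.inl (re_I_mul_add_cosArcsin_pos hz))).const_mul (-Complex.I)
  refine h2.congr_deriv ?_
  have h3 := cosArcsin_ne_zero hz
  have h4 : Complex.I * z + cosArcsin z ≠ 0 :=
    left_ne_zero_of_mul_eq_one (mul_cosArcsin_sub (z := z))
  field_simp
  linear_combination -(cosArcsin z) * Complex.I_sq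

omit hz in
lemma cos_two_mul_arcsin : Complex.cos (2 * arcsin z) = 1 - 2 * z ^ 2 := by
  have h1 := mul_cosArcsin_sub (z := z)
  have h4 : Complex.I * z + cosArcsin z ≠ 0 := left_ne_zero_of_mul_eq_one h1
  have h2 : Complex.exp (arcsin z * Complex.I) = Complex.I * z + cosArcsin z := by
    rw [arcsin, ← Complex.exp_log h4]
    congr 1
    rw [Complex.exp_log h4]
    linear_combination -(Complex.log (Complex.I * z + cosArcsin z)) * Complex.I_sq
  have h3 : Complex.cos (arcsin z) = cosArcsin z := by
    rw [Complex.cos, neg_mul, Complex.exp_neg, h2, ← eq_inv_of_mul_eq_one_right h1]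
    ring
  rw [Complex.cos_two_mul, h3]
  linear_combination 2 * cosArcsin_sq (z := z)

lemma abs_re_arcsin_le : |(arcsin z).re| ≤ Real.pi / 2 := by
  have h1 : (arcsin z).re = (Complex.I * z + cosArcsin z).arg := by
    rw [arcsin, ← Complex.log_im]
    simp
  rw [h1]
  exact Complex.abs_arg_le_pi_div_two_iff.2 (re_I_mul_add_cosArcsin_pos hz).le

end Arcsin

lemma cosArcsin_ofReal {x : ℝ} (hx : |x| ≤ 1) : cosArcsin x = √(1 - x ^ 2) := by
  have : 0 ≤ 1 - x ^ 2 := by rw [sub_nonneg, sq_le_one_iff_abs_le_one]; exact hx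
  rw [cosArcsin, Real.sqrt_eq_rpow, Complex.ofReal_cpow this]
  push_cast
  rfl

lemma arcsin_ofReal {x : ℝ} (hx : |x| ≤ 1) : arcsin x = Real.arcsin x := by
  have hx' := abs_le.1 hx
  have h1 : Complex.I * x + cosArcsin x = Complex.exp (Real.arcsin x * Complex.I) := by
    rw [cosArcsin_ofReal hx, ← Real.cos_arcsin, Complex.exp_mul_I, ← Complex.ofReal_cos,
      ← Complex.ofReal_sin, Real.sin_arcsin hx'.1 hx'.2]
    ring
  have hpi := Real.pi_pos
  rw [arcsin, h1, Complex.log_exp]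
  · linear_combination -(Real.arcsin x : ℂ) * Complex.I_sq
  · simp
    linarith [Real.neg_pi_div_two_le_arcsin x]
  · simp
    linarith [Real.arcsin_le_pi_div_two x]

/-! ### The transformed parts of `F` inside the Bernstein ellipse of the s-plane. -/

section Region

variable {T : ℝ} (hT : 1 < T)

/-- The parameter `sin (π / (2T))` of the substitution `sin (π x / (2T)) = σ s`. -/
def sigma (T : ℝ) : ℝ := Real.sin (Real.pi / (2 * T))

/-- The square root `cot (π / (4T))` of the rate `E T`. -/
def rho (T : ℝ) : ℝ := Real.cot (Real.pi / (4 * T))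

lemma E_eq_rho_sq (T : ℝ) : E T = rho T ^ 2 := rfl

lemma c_eq (T : ℝ) : c T = 1 - 2 * sigma T ^ 2 := by
  rw [c, sigma, show Real.pi / T = 2 * (Real.pi / (2 * T)) by ring, Real.cos_two_mul]
  linarith [Real.sin_sq_add_cos_sq (Real.pi / (2 * T))]

include hT

lemma quarter_mem : Real.pi / (4 * T) ∈ Ioo 0 (Real.pi / 4) := by
  have := Real.pi_pos
  refine ⟨by positivity, ?_⟩
  apply div_lt_div_of_pos_left this (by norm_num) (by linarith)

lemma half_mem : Real.pi / (2 * T) ∈ Ioo 0 (Real.pi / 2) := by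
  have := Real.pi_pos
  refine ⟨by positivity, ?_⟩
  apply div_lt_div_of_pos_left this (by norm_num) (by linarith)

lemma sigma_pos : 0 < sigma T :=
  Real.sin_pos_of_pos_of_lt_pi (half_mem hT).1 (by linarith [(half_mem hT).2, Real.pi_pos])

lemma sigma_lt_one : sigma T < 1 := by
  rw [sigma, ← Real.sin_pi_div_two]
  have := half_mem hT
  exact Real.sin_lt_sin_of_lt_of_le_pi_div_two (by linarith [this.1, Real.pi_pos]) le_rfl this.2

lemma one_lt_rho : 1 < rho T := by
  have h := quarter_mem hT
  have hpi := Real.pi_pos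
  have h1 : 0 < Real.tan (Real.pi / (4 * T)) :=
    Real.tan_pos_of_pos_of_lt_pi_div_two h.1 (by linarith [h.2])
  have h2 : Real.tan (Real.pi / (4 * T)) < 1 := by
    rw [← Real.tan_pi_div_four]
    exact Real.tan_lt_tan_of_lt_of_lt_pi_div_two (by linarith [h.1]) (by linarith) h.2
  rw [rho, ← Real.tan_inv_eq_cot]
  exact (one_lt_inv₀ h1).2 h2

/-- The identity cot a + tan a = 2 / sin 2a at a = π/(4T). It places the vertices of the ellipse
e(ρ) exactly at the singularities ±1/σ. -/
lemma sigma_mul_rho : sigma T * (rho T + (rho T)⁻¹) = 2 := by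
  have h := quarter_mem hT
  have hpi := Real.pi_pos
  have hs : 0 < Real.sin (Real.pi / (4 * T)) :=
    Real.sin_pos_of_pos_of_lt_pi h.1 (by linarith [h.2])
  have hc : 0 < Real.cos (Real.pi / (4 * T)) :=
    Real.cos_pos_of_mem_Ioo ⟨by linarith [h.1], by linarith [h.2]⟩
  rw [sigma, rho, Real.cot_eq_cos_div_sin,
    show Real.pi / (2 * T) = 2 * (Real.pi / (4 * T)) by ring, Real.sin_two_mul]
  field_simp
  linarith [Real.sin_sq_add_cos_sq (Real.pi / (4 * T))]

/-- Since r + 1/r increases for r ≥ 1, the interior of e(ρ) lies in the disc |s| < 1/σ, on which the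
principal inverse sine of σs is holomorphic. -/
lemma norm_sigma_mul_joukowski_lt {u : ℂ} (h1 : 1 ≤ ‖u‖) (h2 : ‖u‖ < rho T) :
    ‖(sigma T : ℂ) * joukowski u‖ < 1 := by
  have hσ := sigma_pos hT
  have hu : 0 < ‖u‖ := by linarith
  rw [norm_mul, Complex.norm_real, Real.norm_eq_abs, abs_of_pos hσ, joukowski, norm_div,
    Complex.norm_two]
  have h3 : ‖u + u⁻¹‖ ≤ ‖u‖ + ‖u‖⁻¹ := (norm_add_le _ _).trans (by rw [norm_inv])
  have h4 : ‖u‖ + ‖u‖⁻¹ < rho T + (rho T)⁻¹ := by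
    have hr : 0 < rho T := by linarith
    rw [← sub_pos]
    have : rho T + (rho T)⁻¹ - (‖u‖ + ‖u‖⁻¹)
        = (rho T - ‖u‖) * (1 - (rho T * ‖u‖)⁻¹) := by
      field_simp; ring
    rw [this]
    apply mul_pos (by linarith)
    rw [sub_pos]
    apply inv_lt_one_of_one_lt₀
    nlinarith
  have h5 := sigma_mul_rho hT
  have h6 : sigma T * ‖u + u⁻¹‖ < 2 := by
    rw [← h5]
    exact mul_lt_mul_of_pos_left (h3.trans_lt h4) hσ
  rw [← mul_div_assoc, div_lt_one (by norm_num)]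
  exact h6

lemma arcsin_mem_analyticityRegion {u : ℂ} (h1 : 1 ≤ ‖u‖) (h2 : ‖u‖ < rho T) :
    (2 * T / Real.pi : ℝ) * arcsin (sigma T * joukowski u) ∈ analyticityRegion T := by
  have hz := norm_sigma_mul_joukowski_lt hT h1 h2
  have hpi := Real.pi_pos
  have hT0 : 0 < T := by linarith
  have hTc : (T : ℂ) ≠ 0 := by exact_mod_cast hT0.ne'
  have hpc : (Real.pi : ℂ) ≠ 0 := by exact_mod_cast hpi.ne'
  have hu0 : u ≠ 0 := by rw [← norm_pos_iff]; linarith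
  refine ⟨?_, ?_⟩
  · rw [Complex.re_ofReal_mul, abs_mul, abs_of_pos (by positivity)]
    calc _ ≤ 2 * T / Real.pi * (Real.pi / 2) := by
          gcongr
          exact abs_re_arcsin_le hz
      _ = T := by field_simp
  · have e : (Real.pi : ℂ) * ((2 * T / Real.pi : ℝ) * arcsin (sigma T * joukowski u)) / T
        = 2 * arcsin (sigma T * joukowski u) := by
      push_cast
      field_simp
    rw [e, cos_two_mul_arcsin]
    -- From 2J(u)² = 1 + J(u²) one gets 1 - 2σ²J(u)² = (1 - σ²) + σ²J(-u²), which is the affine map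
    -- at J(-u²). Squaring u takes the parameter ρ to ρ² = E(T).
    refine ⟨joukowski (-u ^ 2), ?_, ?_⟩
    · refine mem_iUnion₂.2 ⟨‖u‖ ^ 2, ⟨one_le_pow₀ h1, ?_⟩, ?_⟩
      · rw [E_eq_rho_sq]
        gcongr
      · refine ⟨(-u ^ 2).arg, ⟨(Complex.neg_pi_lt_arg _).le, Complex.arg_le_pi _⟩, ?_⟩
        have h3 := Complex.norm_mul_exp_arg_mul_I (-u ^ 2)
        rw [norm_neg, norm_pow] at h3
        rw [h3, Complex.exp_neg, ← mul_inv, h3, joukowski]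
        ring
    · rw [affineMap, c_eq, joukowski, joukowski]
      push_cast
      field_simp
      ring

omit hT in
lemma neg_mem_analyticityRegion {z : ℂ} (hz : z ∈ analyticityRegion T) :
    -z ∈ analyticityRegion T := by
  refine ⟨by simpa using hz.1, ?_⟩
  rw [mul_neg, neg_div, Complex.cos_neg]
  exact hz.2

omit hT in
lemma isCompact_closedBernsteinRegion (R : ℝ) : IsCompact (closedBernsteinRegion R) := by
  have e : closedBernsteinRegion R = (fun p : ℝ × ℝ => (1 / 2 : ℂ) * ((p.1 : ℂ)⁻¹
      * Complex.exp (-(p.2 * Complex.I)) + p.1 * Complex.exp (p.2 * Complex.I)))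
      '' (Icc 1 R ×ˢ Icc (-Real.pi) Real.pi) := by
    ext u
    simp only [closedBernsteinRegion, bernsteinEllipse, mem_iUnion, mem_ofPred_eq, mem_image,
      mem_prod, Prod.exists]
    constructor
    · rintro ⟨r, hr, θ, hθ, rfl⟩
      exact ⟨r, θ, ⟨hr, hθ⟩, rfl⟩
    · rintro ⟨r, θ, ⟨hr, hθ⟩, rfl⟩
      exact ⟨r, hr, θ, hθ, rfl⟩
  rw [e]
  apply (isCompact_Icc.prod isCompact_Icc).image_of_continuousOn
  have : ContinuousOn (fun p : ℝ × ℝ => (p.1 : ℂ)⁻¹) (Icc 1 R ×ˢ Icc (-Real.pi) Real.pi) := by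
    apply ContinuousOn.inv₀ (by fun_prop)
    intro p hp
    have : (0 : ℝ) < p.1 := by linarith [hp.1.1]
    exact_mod_cast this.ne'
  fun_prop

/-- The real part is bounded by definition. For the imaginary part, |Im w| ≤ sinh |Im w| ≤ |cos w|,
and the cosine takes values in a compact region. -/
lemma isCompact_analyticityRegion : IsCompact (analyticityRegion T) := by
  have hT0 : 0 < T := by linarith
  have hpi := Real.pi_pos
  have hK : IsCompact (affineMap T '' closedBernsteinRegion (E T)) :=
    (isCompact_closedBernsteinRegion _).image (by unfold affineMap; fun_prop)
  obtain ⟨R, hR⟩ := hK.exists_bound_of_continuousOn continuousOn_id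
  have hclosed : IsClosed (analyticityRegion T) :=
    (isClosed_le (f := fun z : ℂ => |z.re|) (by fun_prop) continuous_const).inter
      (hK.isClosed.preimage (f := fun z : ℂ => Complex.cos (Real.pi * z / T)) (by fun_prop))
  refine Metric.isCompact_of_isClosed_isBounded hclosed
    (isBounded_iff_forall_norm_le.2 ⟨T + T / Real.pi * R, fun z hz => ?_⟩)
  refine (Complex.norm_le_abs_re_add_abs_im z).trans (add_le_add hz.1 ?_)
  have h1 := hR _ hz.2
  rw [id] at h1
  have him : (Real.pi * z / T).im = Real.pi / T * z.im := by
    rw [show (Real.pi : ℂ) * z / T = ((Real.pi / T : ℝ) : ℂ) * z by push_cast; ring,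
      Complex.im_ofReal_mul]
  have h2 : |(Real.pi * z / T).im| ≤ ‖Complex.cos (Real.pi * z / T)‖ := by
    generalize (Real.pi : ℂ) * z / T = w
    have h3 := abs_norm_sub_norm_le (Complex.exp (-w * Complex.I)) (-Complex.exp (w * Complex.I))
    rw [norm_neg, Complex.norm_exp, Complex.norm_exp, sub_neg_eq_add] at h3
    have h4 : Complex.exp (-w * Complex.I) + Complex.exp (w * Complex.I) = 2 * Complex.cos w := by
      rw [Complex.cos]; ring
    have h5 : Real.exp (-w * Complex.I).re - Real.exp (w * Complex.I).re
        = 2 * Real.sinh w.im := by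
      rw [Real.sinh_eq]
      simp
      ring
    rw [h4, h5, norm_mul, Complex.norm_two, abs_mul, Real.abs_sinh, abs_two] at h3
    have h6 := Real.self_le_sinh_iff.2 (abs_nonneg w.im)
    linarith
  rw [him, abs_mul, abs_of_pos (by positivity)] at h2
  have h3 := h2.trans h1
  calc |z.im| = T / Real.pi * (Real.pi / T * |z.im|) := by field_simp
    _ ≤ _ := by gcongr


variable {F : ℂ → ℂ} (hF : AnalyticOnNhd ℂ F (analyticityRegion T))

include hF

lemma exists_bound_on_analyticityRegion :
    ∃ M : ℝ, 0 ≤ M ∧ ∀ z ∈ analyticityRegion T, ‖F z‖ ≤ M ∧ ‖deriv F z‖ ≤ M := by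
  have hK := isCompact_analyticityRegion hT
  obtain ⟨M1, h1⟩ := hK.exists_bound_of_continuousOn hF.continuousOn
  obtain ⟨M2, h2⟩ := hK.exists_bound_of_continuousOn hF.deriv.continuousOn
  exact ⟨max 0 (max M1 M2), le_max_left _ _, fun z hz =>
    ⟨(h1 z hz).trans ((le_max_left _ _).trans (le_max_right _ _)),
      (h2 z hz).trans ((le_max_right _ _).trans (le_max_right _ _))⟩⟩

omit hF in
/-- The even part of `F` as a function of `s = sin (π x / (2T)) / σ`. -/
def evenPart (T : ℝ) (F : ℂ → ℂ) (s : ℂ) : ℂ :=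
  (F ((2 * T / Real.pi : ℝ) * arcsin (sigma T * s))
    + F (-((2 * T / Real.pi : ℝ) * arcsin (sigma T * s)))) / 2

omit hF in
/-- The odd part of `F`, divided by `cos (π x / (2T))`, as a function of
`s = sin (π x / (2T)) / σ`. -/
def oddPart (T : ℝ) (F : ℂ → ℂ) (s : ℂ) : ℂ :=
  (F ((2 * T / Real.pi : ℝ) * arcsin (sigma T * s))
    - F (-((2 * T / Real.pi : ℝ) * arcsin (sigma T * s)))) / 2 / cosArcsin (sigma T * s)

omit hT hF in
lemma hasDerivAt_arcsin_sigma_mul {s : ℂ} (hs : ‖(sigma T : ℂ) * s‖ < 1) :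
    HasDerivAt (fun s => ((2 * T / Real.pi : ℝ) : ℂ) * arcsin (sigma T * s))
      (((2 * T / Real.pi : ℝ) : ℂ) * (sigma T / cosArcsin (sigma T * s))) s := by
  have h1 : HasDerivAt (fun s : ℂ => (sigma T : ℂ) * s) (sigma T) s := by
    simpa using (hasDerivAt_id s).const_mul (sigma T : ℂ)
  have h2 := ((hasDerivAt_arcsin hs).comp s h1).const_mul ((2 * T / Real.pi : ℝ) : ℂ)
  exact h2.congr_deriv (by ring)

/-- The only unbounded factor is 1/√(1-σ²s²), so the singularity of this derivative has order at
most -1/2. -/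
lemma hasDerivAt_evenPart {u : ℂ} (h1 : 1 ≤ ‖u‖) (h2 : ‖u‖ < rho T) :
    let x := (2 * T / Real.pi : ℝ) * arcsin (sigma T * joukowski u)
    HasDerivAt (evenPart T F) ((deriv F x - deriv F (-x)) / 2 * (((2 * T / Real.pi : ℝ) : ℂ)
      * (sigma T / cosArcsin (sigma T * joukowski u)))) (joukowski u) := by
  intro x
  have hz := norm_sigma_mul_joukowski_lt hT h1 h2
  have hx := arcsin_mem_analyticityRegion hT h1 h2
  have hd := hasDerivAt_arcsin_sigma_mul hz
  have e1 := (hF x hx).differentiableAt.hasDerivAt.comp (joukowski u) hd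
  have e2 := (hF (-x) (neg_mem_analyticityRegion hx)).differentiableAt.hasDerivAt.comp
    (joukowski u) hd.neg
  exact ((e1.add e2).div_const 2).congr_deriv (by ring)

/-- Dividing the odd part by √(1-σ²s²) is what creates the cube of that root in the denominator,
hence the exponent -3/2 required in the Chebyshev estimate. -/
lemma hasDerivAt_oddPart {u : ℂ} (h1 : 1 ≤ ‖u‖) (h2 : ‖u‖ < rho T) :
    let x := (2 * T / Real.pi : ℝ) * arcsin (sigma T * joukowski u)
    let w := cosArcsin (sigma T * joukowski u)
    HasDerivAt (oddPart T F) ((deriv F x + deriv F (-x)) / 2 * (2 * T / Real.pi : ℝ)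
      * (sigma T / w ^ 2) + (F x - F (-x)) / 2 * (sigma T * (sigma T * joukowski u) / w ^ 3))
      (joukowski u) := by
  intro x w
  have hz := norm_sigma_mul_joukowski_lt hT h1 h2
  have hx := arcsin_mem_analyticityRegion hT h1 h2
  have hd := hasDerivAt_arcsin_sigma_mul hz
  have hw0 : w ≠ 0 := cosArcsin_ne_zero hz
  have e1 := (hF x hx).differentiableAt.hasDerivAt.comp (joukowski u) hd
  have e2 := (hF (-x) (neg_mem_analyticityRegion hx)).differentiableAt.hasDerivAt.comp
    (joukowski u) hd.neg
  have e0 : HasDerivAt (fun s : ℂ => (sigma T : ℂ) * s) (sigma T) (joukowski u) := by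
    simpa using (hasDerivAt_id (joukowski u)).const_mul (sigma T : ℂ)
  have e3 := (hasDerivAt_cosArcsin hz).comp (joukowski u) e0
  refine ((((e1.sub e2).div_const 2).div e3) hw0).congr_deriv ?_
  simp only [Function.comp_apply, Pi.sub_apply, Pi.neg_apply]
  change _ / w ^ 2 = _
  rw [show cosArcsin (sigma T * joukowski u) = w from rfl]
  field_simp
  ring

omit hT hF in
lemma norm_rpow_eq_norm_cosArcsin {z : ℂ} :
    ‖1 - z ^ 2‖ ^ (-(3 / 2) : ℝ) = (‖cosArcsin z‖ ^ 3)⁻¹ := by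
  rw [← cosArcsin_sq, norm_pow, ← Real.rpow_natCast, ← Real.rpow_mul (norm_nonneg _),
    ← Real.rpow_natCast, ← Real.rpow_neg (norm_nonneg _)]
  norm_num

omit hT hF in
lemma norm_cosArcsin_sq_le {z : ℂ} (hz : ‖z‖ < 1) : ‖cosArcsin z‖ ^ 2 ≤ 2 := by
  rw [← norm_pow, cosArcsin_sq]
  refine (norm_sub_le _ _).trans ?_
  rw [norm_one, norm_pow]
  have := pow_le_one₀ (n := 2) (norm_nonneg z) hz.le
  linarith

lemma exists_polynomial_approx_evenPart : ∃ A : ℝ, ∀ N : ℕ, ∃ p : Polynomial ℂ,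
    p.natDegree ≤ N ∧ ∀ s ∈ Icc (-1 : ℝ) 1,
      ‖evenPart T F s - p.eval (s : ℂ)‖ ≤ A / √(N + 1) * (rho T)⁻¹ ^ N := by
  obtain ⟨M, hM0, hM⟩ := exists_bound_on_analyticityRegion hT hF
  have hσ := sigma_pos hT
  have hpi := Real.pi_pos
  have hT0 : 0 < T := by linarith
  have hκ : 0 < 2 * T / Real.pi := by positivity
  refine exists_polynomial_approx (B := M * (2 * T / Real.pi * sigma T) * 2) (one_lt_rho hT)
    (sigma_mul_rho hT) (fun u h1 h2 => (hasDerivAt_evenPart hT hF h1 h2).differentiableAt)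
    (by positivity) fun u h1 h2 => ?_
  rw [(hasDerivAt_evenPart hT hF h1 h2).deriv]
  have hz := norm_sigma_mul_joukowski_lt hT h1 h2
  have hx := arcsin_mem_analyticityRegion hT h1 h2
  have b1 := (hM _ hx).2
  have b2 := (hM _ (neg_mem_analyticityRegion hx)).2
  have b3 := norm_cosArcsin_sq_le hz
  have b4 : 0 < ‖cosArcsin (sigma T * joukowski u)‖ := norm_pos_iff.2 (cosArcsin_ne_zero hz)
  rw [norm_rpow_eq_norm_cosArcsin]
  set x := (2 * T / Real.pi : ℝ) * arcsin (sigma T * joukowski u)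
  set w := cosArcsin (sigma T * joukowski u)
  have b5 : ‖(deriv F x - deriv F (-x)) / 2‖ ≤ M := by
    rw [norm_div, Complex.norm_two, div_le_iff₀ two_pos]
    linarith [norm_sub_le (deriv F x) (deriv F (-x))]
  rw [norm_mul, norm_mul, norm_div (sigma T : ℂ), Complex.norm_real, Complex.norm_real,
    Real.norm_eq_abs, Real.norm_eq_abs, abs_of_pos hκ, abs_of_pos hσ]
  calc _ ≤ M * (2 * T / Real.pi * (sigma T / ‖w‖)) := by gcongr
    -- The order -1/2 is deliberately weakened to -3/2, using ‖w‖² ≤ 2, so that one approximation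
    -- theorem serves both parities.
    _ = M * (2 * T / Real.pi * sigma T) * ‖w‖ ^ 2 * (‖w‖ ^ 3)⁻¹ := by
        field_simp
    _ ≤ _ := by gcongr

lemma exists_polynomial_approx_oddPart : ∃ A : ℝ, ∀ N : ℕ, ∃ p : Polynomial ℂ,
    p.natDegree ≤ N ∧ ∀ s ∈ Icc (-1 : ℝ) 1,
      ‖oddPart T F s - p.eval (s : ℂ)‖ ≤ A / √(N + 1) * (rho T)⁻¹ ^ N := by
  obtain ⟨M, hM0, hM⟩ := exists_bound_on_analyticityRegion hT hF
  have hσ := sigma_pos hT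
  have hpi := Real.pi_pos
  have hT0 : 0 < T := by linarith
  have hκ : 0 < 2 * T / Real.pi := by positivity
  refine exists_polynomial_approx (B := M * (2 * T / Real.pi) * sigma T * 2 + M * sigma T)
    (one_lt_rho hT) (sigma_mul_rho hT)
    (fun u h1 h2 => (hasDerivAt_oddPart hT hF h1 h2).differentiableAt)
    (by positivity) fun u h1 h2 => ?_
  rw [(hasDerivAt_oddPart hT hF h1 h2).deriv]
  have hz := norm_sigma_mul_joukowski_lt hT h1 h2
  have hx := arcsin_mem_analyticityRegion hT h1 h2
  have hx' := neg_mem_analyticityRegion hx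
  have b1 := hM _ hx
  have b2 := hM _ hx'
  have b3 := norm_cosArcsin_sq_le hz
  have b4 : 0 < ‖cosArcsin (sigma T * joukowski u)‖ := norm_pos_iff.2 (cosArcsin_ne_zero hz)
  rw [norm_rpow_eq_norm_cosArcsin]
  set x := (2 * T / Real.pi : ℝ) * arcsin (sigma T * joukowski u)
  set w := cosArcsin (sigma T * joukowski u)
  have b5 : ‖(deriv F x + deriv F (-x)) / 2‖ ≤ M := by
    rw [norm_div, Complex.norm_two, div_le_iff₀ two_pos]
    linarith [norm_add_le (deriv F x) (deriv F (-x)), b1.2, b2.2]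
  have b6 : ‖(F x - F (-x)) / 2‖ ≤ M := by
    rw [norm_div, Complex.norm_two, div_le_iff₀ two_pos]
    linarith [norm_sub_le (F x) (F (-x)), b1.1, b2.1]
  have b7 : ‖w‖ ≤ 2 := by nlinarith
  refine (norm_add_le _ _).trans ?_
  rw [norm_mul, norm_mul, norm_mul _ (_ / w ^ 3), norm_div (sigma T : ℂ), norm_div _ (w ^ 3),
    norm_mul (sigma T : ℂ) (_ * _), norm_pow, norm_pow, Complex.norm_real, Complex.norm_real,
    Real.norm_eq_abs, Real.norm_eq_abs, abs_of_pos hκ, abs_of_pos hσ]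
  calc _ ≤ M * (2 * T / Real.pi) * (sigma T / ‖w‖ ^ 2) + M * (sigma T * 1 / ‖w‖ ^ 3) := by
        gcongr
    _ = (M * (2 * T / Real.pi) * sigma T * ‖w‖ + M * sigma T) * (‖w‖ ^ 3)⁻¹ := by
        field_simp
    _ ≤ _ := by gcongr

end Region

/-! ### The space G_n: existence, uniqueness and orthogonality of the extension. -/

section

/-- `cos (π k x / T)`. -/
def cosWave (T : ℝ) (k : ℕ) (x : ℝ) : ℂ := (Real.cos (Real.pi / T * k * x) : ℂ)

/-- `sin (π k x / T)`. -/
def sinWave (T : ℝ) (k : ℕ) (x : ℝ) : ℂ := (Real.sin (Real.pi / T * k * x) : ℂ)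

/-- The space `G_n` as a submodule. -/
def fourierSubmodule (T : ℝ) (n : ℕ) : Submodule ℂ (ℝ → ℂ) :=
  Submodule.span ℂ (cosWave T '' Iic n ∪ sinWave T '' Iic n)

variable {T : ℝ} {n : ℕ}

lemma cosWave_mem {k : ℕ} (hk : k ≤ n) : cosWave T k ∈ fourierSubmodule T n :=
  Submodule.subset_span (Or.inl ⟨k, hk, rfl⟩)

lemma sinWave_mem {k : ℕ} (hk : k ≤ n) : sinWave T k ∈ fourierSubmodule T n :=
  Submodule.subset_span (Or.inr ⟨k, hk, rfl⟩)

lemma fourierSubmodule_mono {m n : ℕ} (h : m ≤ n) :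
    fourierSubmodule T m ≤ fourierSubmodule T n :=
  Submodule.span_mono (union_subset_union (image_mono (Iic_subset_Iic.2 h))
    (image_mono (Iic_subset_Iic.2 h)))

lemma trigPoly_eq (α β : ℕ → ℂ) : trigPoly T n α β = (α 0 / 2) • cosWave T 0
    + ∑ k ∈ Finset.Icc 1 n, (α k • cosWave T k + β k • sinWave T k) := by
  ext x
  simp [trigPoly, cosWave, sinWave]

lemma mem_fourierSpace_iff {g : ℝ → ℂ} : g ∈ fourierSpace T n ↔ g ∈ fourierSubmodule T n := by
  constructor
  · rintro ⟨α, β, rfl⟩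
    rw [trigPoly_eq]
    refine Submodule.add_mem _ (Submodule.smul_mem _ _ (cosWave_mem (Nat.zero_le n)))
      (Submodule.sum_mem _ fun k hk => ?_)
    have := (Finset.mem_Icc.1 hk).2
    exact Submodule.add_mem _ (Submodule.smul_mem _ _ (cosWave_mem this))
      (Submodule.smul_mem _ _ (sinWave_mem this))
  · intro hg
    induction hg using Submodule.span_induction with
    | mem g hg =>
      rcases hg with ⟨k, hk, rfl⟩ | ⟨k, hk, rfl⟩
      -- The value 2 compensates for the constant term α₀/2.
      · refine ⟨Pi.single k (if k = 0 then 2 else 1), 0, ?_⟩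
        rw [trigPoly_eq]
        rcases eq_or_ne k 0 with rfl | h0
        · simp only [if_true, Pi.single_eq_same, Pi.zero_apply, zero_smul, add_zero]
          rw [Finset.sum_eq_zero]
          · simp
          · intro j hj
            have : j ≠ 0 := by have := Finset.mem_Icc.1 hj; omega
            rw [Pi.single_eq_of_ne this, zero_smul]
        · rw [Finset.sum_eq_single k]
          · simp [h0]
          · intro j _ hj
            simp [Pi.single_eq_of_ne hj]
          · intro h
            exact absurd (Finset.mem_Icc.2 ⟨Nat.one_le_iff_ne_zero.2 h0, hk⟩) h
      · rcases eq_or_ne k 0 with rfl | h0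
        · refine ⟨0, 0, ?_⟩
          ext x
          simp [trigPoly, sinWave]
        · refine ⟨0, Pi.single k 1, ?_⟩
          rw [trigPoly_eq, Finset.sum_eq_single k]
          · simp
          · intro j _ hj
            simp [Pi.single_eq_of_ne hj]
          · intro h
            exact absurd (Finset.mem_Icc.2 ⟨Nat.one_le_iff_ne_zero.2 h0, hk⟩) h
    | zero => exact ⟨0, 0, by ext x; simp [trigPoly]⟩
    | add g h _ _ hg hh =>
      obtain ⟨α, β, rfl⟩ := hg
      obtain ⟨α', β', rfl⟩ := hh
      refine ⟨α + α', β + β', ?_⟩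
      simp only [trigPoly_eq, Pi.add_apply, add_smul, add_div, Finset.sum_add_distrib]
      abel
    | smul a g _ hg =>
      obtain ⟨α, β, rfl⟩ := hg
      refine ⟨a • α, a • β, ?_⟩
      simp only [trigPoly_eq, Pi.smul_apply, smul_add, Finset.smul_sum, smul_smul, smul_eq_mul,
        mul_div_assoc]

lemma cosWave_one_mul_mem {g : ℝ → ℂ} (hg : g ∈ fourierSubmodule T n) :
    cosWave T 1 * g ∈ fourierSubmodule T (n + 1) := by
  induction hg using Submodule.span_induction with
  | mem g hg =>
    rcases hg with ⟨k, hk, rfl⟩ | ⟨k, hk, rfl⟩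
    · rcases k with _ | k
      · have : cosWave T 1 * cosWave T 0 = cosWave T 1 := by
          ext x; simp [cosWave]
        rw [this]
        exact cosWave_mem (by omega)
      · have : cosWave T 1 * cosWave T (k + 1)
            = (1 / 2 : ℂ) • (cosWave T (k + 2) + cosWave T k) := by
          ext x
          simp only [cosWave, Pi.mul_apply, Pi.smul_apply, Pi.add_apply, smul_eq_mul]
          rw [show Real.pi / T * ((k + 2 : ℕ) : ℝ) * x
            = Real.pi / T * ((k + 1 : ℕ) : ℝ) * x + Real.pi / T * (1 : ℕ) * x by push_cast; ring,
            show Real.pi / T * (k : ℝ) * x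
            = Real.pi / T * ((k + 1 : ℕ) : ℝ) * x - Real.pi / T * (1 : ℕ) * x by push_cast; ring,
            Real.cos_add, Real.cos_sub]
          push_cast
          ring
        rw [this]
        have hk' : k + 1 ≤ n := hk
        exact Submodule.smul_mem _ _ (Submodule.add_mem _ (cosWave_mem (by omega))
          (cosWave_mem (by omega)))
    · rcases k with _ | k
      · have : cosWave T 1 * sinWave T 0 = 0 := by
          ext x; simp [sinWave]
        rw [this]
        exact Submodule.zero_mem _
      · have : cosWave T 1 * sinWave T (k + 1)
            = (1 / 2 : ℂ) • (sinWave T (k + 2) + sinWave T k) := by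
          ext x
          simp only [cosWave, sinWave, Pi.mul_apply, Pi.smul_apply, Pi.add_apply, smul_eq_mul]
          rw [show Real.pi / T * ((k + 2 : ℕ) : ℝ) * x
            = Real.pi / T * ((k + 1 : ℕ) : ℝ) * x + Real.pi / T * (1 : ℕ) * x by push_cast; ring,
            show Real.pi / T * (k : ℝ) * x
            = Real.pi / T * ((k + 1 : ℕ) : ℝ) * x - Real.pi / T * (1 : ℕ) * x by push_cast; ring,
            Real.sin_add, Real.sin_sub]
          push_cast
          ring
        rw [this]
        have hk' : k + 1 ≤ n := hk
        exact Submodule.smul_mem _ _ (Submodule.add_mem _ (sinWave_mem (by omega))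
          (sinWave_mem (by omega)))
  | zero => rw [mul_zero]; exact Submodule.zero_mem _
  | add g h _ _ hg hh => rw [mul_add]; exact Submodule.add_mem _ hg hh
  | smul a g _ hg => rw [mul_smul_comm]; exact Submodule.smul_mem _ _ hg

/-- Supplies the test functions: 1 - cos(πx/T) is 2σ²s² after the substitution, so these powers
produce the monomials s^(2i). -/
lemma one_sub_cosWave_pow_mul_mem {g : ℝ → ℂ} (hg : g ∈ fourierSubmodule T n) (i : ℕ) :
    (1 - cosWave T 1) ^ i * g ∈ fourierSubmodule T (n + i) := by
  induction i with
  | zero => simpa using hg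
  | succ i ih =>
    have : (1 - cosWave T 1) ^ (i + 1) * g
        = (1 - cosWave T 1) ^ i * g - cosWave T 1 * ((1 - cosWave T 1) ^ i * g) := by ring
    rw [this]
    exact Submodule.sub_mem _ (fourierSubmodule_mono (by omega) ih) (cosWave_one_mul_mem ih)

lemma star_mem_fourierSubmodule {g : ℝ → ℂ} (hg : g ∈ fourierSubmodule T n) :
    star g ∈ fourierSubmodule T n := by
  obtain ⟨α, β, rfl⟩ := mem_fourierSpace_iff.2 hg
  refine mem_fourierSpace_iff.1 ⟨star α, star β, ?_⟩
  ext x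
  simp [trigPoly, -Complex.ofReal_cos, -Complex.ofReal_sin]

lemma analyticOnNhd_of_mem {g : ℝ → ℂ} (hg : g ∈ fourierSubmodule T n) :
    AnalyticOnNhd ℝ g univ := by
  obtain ⟨α, β, rfl⟩ := mem_fourierSpace_iff.2 hg
  intro x _
  have hof : ∀ u : ℝ → ℝ, AnalyticAt ℝ u x → AnalyticAt ℝ (fun x => (u x : ℂ)) x := fun u hu =>
    (Complex.ofRealCLM.analyticAt _).comp hu
  unfold trigPoly
  refine analyticAt_const.add (Finset.analyticAt_fun_sum _ fun k _ => ?_)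
  refine (analyticAt_const.mul (hof _ ?_)).add (analyticAt_const.mul (hof _ ?_))
  · exact Real.analyticAt_cos.comp (analyticAt_const.mul analyticAt_id)
  · exact Real.analyticAt_sin.comp (analyticAt_const.mul analyticAt_id)

lemma continuous_of_mem {g : ℝ → ℂ} (hg : g ∈ fourierSubmodule T n) : Continuous g :=
  continuousOn_univ.1 (analyticOnNhd_of_mem hg).continuousOn

lemma memLp_of_continuousOn {g : ℝ → ℂ} (hg : ContinuousOn g (Icc (-1 : ℝ) 1)) :
    MemLp g 2 (volume.restrict (Icc (-1 : ℝ) 1)) := by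
  obtain ⟨C, hC⟩ := isCompact_Icc.exists_bound_of_continuousOn hg
  refine MemLp.of_bound (hg.aestronglyMeasurable measurableSet_Icc) C ?_
  exact (ae_restrict_iff' measurableSet_Icc).2 (Filter.Eventually.of_forall hC)

lemma memLp_of_mem {g : ℝ → ℂ} (hg : g ∈ fourierSubmodule T n) :
    MemLp g 2 (volume.restrict (Icc (-1 : ℝ) 1)) :=
  memLp_of_continuousOn (continuous_of_mem hg).continuousOn

/-- The inclusion of `G_n` into `L²[-1,1]`. -/
def toL2 (T : ℝ) (n : ℕ) :
    fourierSubmodule T n →ₗ[ℂ] Lp ℂ 2 (volume.restrict (Icc (-1 : ℝ) 1)) where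
  toFun g := (memLp_of_mem g.2).toLp
  map_add' _ _ := rfl
  map_smul' _ _ := rfl

/-- Trigonometric polynomials are real-analytic, so agreement almost everywhere on [-1,1] forces
agreement on the whole line. This is why the minimizer is unique as a function on ℝ. -/
lemma toL2_injective : Function.Injective (toL2 T n) := by
  rintro ⟨g, hg⟩ ⟨h, hh⟩ e
  have e1 : g =ᵐ[volume.restrict (Icc (-1 : ℝ) 1)] h :=
    (MemLp.toLp_eq_toLp_iff (memLp_of_mem hg) (memLp_of_mem hh)).1 e
  have e2 := Measure.eqOn_Icc_of_ae_eq (μ := volume) (by norm_num) e1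
    (continuous_of_mem hg).continuousOn (continuous_of_mem hh).continuousOn
  apply Subtype.ext
  apply (analyticOnNhd_of_mem hg).eq_of_eventuallyEq (analyticOnNhd_of_mem hh) (z₀ := 0)
  filter_upwards [Icc_mem_nhds (show (-1 : ℝ) < 0 by norm_num) (show (0 : ℝ) < 1 by norm_num)]
    with x hx using e2 hx

instance : FiniteDimensional ℂ (fourierSubmodule T n) :=
  FiniteDimensional.span_of_finite ℂ
    (((finite_Iic n).image _).union ((finite_Iic n).image _))

section Extension

variable {f : ℝ → ℂ} (hf : ContinuousOn f (Icc (-1 : ℝ) 1))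
include hf

lemma isFourierExtension_iff {g : ℝ → ℂ} (hg : g ∈ fourierSubmodule T n) :
    IsFourierExtension T n f g ↔ ∀ w ∈ LinearMap.range (toL2 T n),
      inner ℂ ((memLp_of_continuousOn hf).toLp - toL2 T n ⟨g, hg⟩) w = 0 := by
  have hfin : ∀ h (hh : h ∈ fourierSubmodule T n),
      eLpNorm (fun x => f x - h x) 2 (volume.restrict (Icc (-1 : ℝ) 1))
        = ENNReal.ofReal ‖(memLp_of_continuousOn hf).toLp - toL2 T n ⟨h, hh⟩‖ := by
    intro h hh
    have e : (memLp_of_continuousOn hf).toLp - toL2 T n ⟨h, hh⟩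
        = ((memLp_of_continuousOn hf).sub (memLp_of_mem hh)).toLp := rfl
    rw [e, Lp.norm_toLp, ENNReal.ofReal_toReal
      ((memLp_of_continuousOn hf).sub (memLp_of_mem hh)).2.ne]
    rfl
  rw [← Submodule.norm_eq_iInf_iff_inner_eq_zero _ (LinearMap.mem_range_self _ _)]
  have hbdd : BddBelow (range fun w : LinearMap.range (toL2 T n) =>
      ‖(memLp_of_continuousOn hf).toLp - w.1‖) := ⟨0, by rintro _ ⟨w, rfl⟩; exact norm_nonneg _⟩
  constructor
  · intro h
    refine le_antisymm (le_ciInf ?_) (ciInf_le hbdd ⟨_, LinearMap.mem_range_self _ _⟩)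
    rintro ⟨_, ⟨⟨v, hv⟩, rfl⟩⟩
    have := h.2 v (mem_fourierSpace_iff.2 hv)
    rw [hfin g hg, hfin v hv] at this
    exact (ENNReal.ofReal_le_ofReal_iff (norm_nonneg _)).1 this
  · intro h
    refine ⟨mem_fourierSpace_iff.2 hg, fun v hv => ?_⟩
    have hv' := mem_fourierSpace_iff.1 hv
    rw [hfin g hg, hfin v hv', h]
    have := ciInf_le hbdd (⟨toL2 T n ⟨v, hv'⟩, LinearMap.mem_range_self _ _⟩ :
      LinearMap.range (toL2 T n))
    exact ENNReal.ofReal_le_ofReal this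

theorem existsUnique_isFourierExtension : ∃! g : ℝ → ℂ, IsFourierExtension T n f g := by
  obtain ⟨_, ⟨⟨g, hg⟩, rfl⟩, hmin⟩ :=
    (LinearMap.range (toL2 T n)).exists_norm_eq_iInf_of_complete_subspace
      (Submodule.complete_of_finiteDimensional _) (memLp_of_continuousOn hf).toLp
  have hgi := (Submodule.norm_eq_iInf_iff_inner_eq_zero _ (LinearMap.mem_range_self _ _)).1 hmin
  refine ⟨g, (isFourierExtension_iff hf hg).2 hgi, fun h hh => ?_⟩
  have hh' := mem_fourierSpace_iff.1 hh.1
  have hhi := (isFourierExtension_iff hf hh').1 hh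
  have hw : toL2 T n ⟨h, hh'⟩ - toL2 T n ⟨g, hg⟩ ∈ LinearMap.range (toL2 T n) :=
    Submodule.sub_mem _ (LinearMap.mem_range_self _ _) (LinearMap.mem_range_self _ _)
  have h1 := hgi _ hw
  have h2 := hhi _ hw
  have h3 : inner ℂ (toL2 T n ⟨h, hh'⟩ - toL2 T n ⟨g, hg⟩)
      (toL2 T n ⟨h, hh'⟩ - toL2 T n ⟨g, hg⟩) = 0 := by
    calc _ = inner ℂ (((memLp_of_continuousOn hf).toLp - toL2 T n ⟨g, hg⟩)
          - ((memLp_of_continuousOn hf).toLp - toL2 T n ⟨h, hh'⟩))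
          (toL2 T n ⟨h, hh'⟩ - toL2 T n ⟨g, hg⟩) := by rw [sub_sub_sub_cancel_left]
      _ = 0 := by rw [inner_sub_left, h1, h2, sub_zero]
  have h4 := sub_eq_zero.1 (inner_self_eq_zero.1 h3)
  exact congrArg Subtype.val (toL2_injective h4)

/-- The projection theorem makes the error orthogonal to G_n. Testing with the conjugate of h, which
is also in G_n, gives the relation without conjugates. -/
lemma integral_error_mul_eq_zero {g h : ℝ → ℂ} (hg : IsFourierExtension T n f g)
    (hh : h ∈ fourierSubmodule T n) : ∫ x in (-1 : ℝ)..1, (f x - g x) * h x = 0 := by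
  have hg' := mem_fourierSpace_iff.1 hg.1
  have h1 := (isFourierExtension_iff hf hg').1 hg _
    (LinearMap.mem_range_self (toL2 T n) ⟨star h, star_mem_fourierSubmodule hh⟩)
  rw [inner_eq_zero_symm, L2.inner_def] at h1
  rw [intervalIntegral.integral_of_le (by norm_num), ← integral_Icc_eq_integral_Ioc, ← h1]
  refine integral_congr_ae ?_
  have e1 := ((memLp_of_continuousOn hf).sub (memLp_of_mem hg')).coeFn_toLp
  have e2 := (memLp_of_mem (star_mem_fourierSubmodule hh)).coeFn_toLp
  filter_upwards [e1, e2] with x hx1 hx2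
  change _ = inner ℂ (((memLp_of_mem (star_mem_fourierSubmodule hh)).toLp :
      Lp ℂ 2 (volume.restrict (Icc (-1 : ℝ) 1))) x)
    ((((memLp_of_continuousOn hf).sub (memLp_of_mem hg')).toLp :
      Lp ℂ 2 (volume.restrict (Icc (-1 : ℝ) 1))) x)
  rw [hx1, hx2]
  simp

end Extension

end

/-! ### The substitution on the real interval. -/

/-- The substitution `x = (2T / π) arcsin (σ s)`, which maps `[-1,1]` onto itself. -/
def subst (T s : ℝ) : ℝ := 2 * T / Real.pi * Real.arcsin (sigma T * s)

/-- The square root `√(1 - σ² s²)`, which is `cos (π x / (2T))` for `x = subst T s`. -/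
def cosHalf (T s : ℝ) : ℝ := √(1 - (sigma T * s) ^ 2)

section Substitution

variable {T : ℝ}

lemma subst_neg (s : ℝ) : subst T (-s) = -subst T s := by
  rw [subst, subst, mul_neg, Real.arcsin_neg, mul_neg]

lemma cosHalf_neg (s : ℝ) : cosHalf T (-s) = cosHalf T s := by
  rw [cosHalf, cosHalf, mul_neg, neg_sq]

lemma continuous_subst : Continuous (subst T) :=
  continuous_const.mul (Real.continuous_arcsin.comp (continuous_const.mul continuous_id))

lemma continuous_cosHalf : Continuous (cosHalf T) := by
  unfold cosHalf; fun_prop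

lemma neg_mem_Icc_neg_one_one {s : ℝ} (hs : s ∈ Icc (-1 : ℝ) 1) : -s ∈ Icc (-1 : ℝ) 1 :=
  ⟨by linarith [hs.2], by linarith [hs.1]⟩

variable (hT : 1 < T)
include hT

lemma subst_one : subst T 1 = 1 := by
  have h := half_mem hT
  have hT0 : T ≠ 0 := by linarith
  rw [subst, sigma, mul_one, Real.arcsin_sin (by linarith [h.1, Real.pi_pos]) h.2.le]
  have := Real.pi_ne_zero
  field_simp

lemma subst_mem {s : ℝ} (hs : s ∈ Icc (-1 : ℝ) 1) : subst T s ∈ Icc (-1 : ℝ) 1 := by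
  have hσ := sigma_pos hT
  have hmono : Monotone (subst T) := by
    intro a b hab
    unfold subst
    have := Real.pi_pos
    gcongr
  have h1 := hmono hs.1
  have h2 := hmono hs.2
  rw [subst_neg, subst_one hT] at h1
  rw [subst_one hT] at h2
  exact ⟨h1, h2⟩

lemma exists_subst_eq {x : ℝ} (hx : x ∈ Icc (-1 : ℝ) 1) : ∃ s ∈ Icc (-1 : ℝ) 1, subst T s = x := by
  have h := intermediate_value_Icc (show (-1 : ℝ) ≤ 1 by norm_num)
    (continuous_subst (T := T)).continuousOn
  rw [subst_neg, subst_one hT] at h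
  exact h hx

lemma abs_sigma_mul_le {s : ℝ} (hs : s ∈ Icc (-1 : ℝ) 1) : |sigma T * s| ≤ sigma T := by
  have hσ := sigma_pos hT
  rw [abs_mul, abs_of_pos hσ]
  exact mul_le_of_le_one_right hσ.le (abs_le.2 hs)

lemma abs_sigma_mul_lt_one {s : ℝ} (hs : s ∈ Icc (-1 : ℝ) 1) : |sigma T * s| < 1 :=
  (abs_sigma_mul_le hT hs).trans_lt (sigma_lt_one hT)

lemma cosHalf_sq {s : ℝ} (hs : s ∈ Icc (-1 : ℝ) 1) : cosHalf T s ^ 2 = 1 - (sigma T * s) ^ 2 := by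
  rw [cosHalf, Real.sq_sqrt]
  rw [sub_nonneg, sq_le_one_iff_abs_le_one]
  exact (abs_sigma_mul_lt_one hT hs).le

lemma cosHalf_one_pos : 0 < cosHalf T 1 := by
  rw [cosHalf, Real.sqrt_pos, sub_pos, sq_lt_one_iff_abs_lt_one]
  exact abs_sigma_mul_lt_one hT (by simp)

lemma cosHalf_one_le {s : ℝ} (hs : s ∈ Icc (-1 : ℝ) 1) : cosHalf T 1 ≤ cosHalf T s := by
  apply Real.sqrt_le_sqrt
  have h1 := abs_sigma_mul_le hT hs
  have h2 : (sigma T * s) ^ 2 ≤ sigma T ^ 2 := sq_le_sq.2 (h1.trans (le_abs_self _))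
  rw [mul_one]
  linarith

lemma cosHalf_pos {s : ℝ} (hs : s ∈ Icc (-1 : ℝ) 1) : 0 < cosHalf T s :=
  (cosHalf_one_pos hT).trans_le (cosHalf_one_le hT hs)

omit hT in
lemma cosHalf_le_one (s : ℝ) : cosHalf T s ≤ 1 := by
  refine Real.sqrt_le_iff.2 ⟨zero_le_one, ?_⟩
  linarith [sq_nonneg (sigma T * s)]

/-- The difference of the squares is σ²(t² - s²), and the sum of the two roots is at least 2
`cosHalf T 1`. -/
lemma abs_cosHalf_sub_le {s t : ℝ} (hs : s ∈ Icc (-1 : ℝ) 1) (ht : t ∈ Icc (-1 : ℝ) 1) :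
    |cosHalf T s - cosHalf T t| ≤ (cosHalf T 1)⁻¹ * |s - t| := by
  have h0 := cosHalf_one_pos hT
  have h1 := cosHalf_one_le hT hs
  have h2 := cosHalf_one_le hT ht
  have hσ := sigma_pos hT
  have hσ1 := sigma_lt_one hT
  have e : (cosHalf T s - cosHalf T t) * (cosHalf T s + cosHalf T t)
      = sigma T ^ 2 * (t + s) * (t - s) := by
    linear_combination cosHalf_sq hT hs - cosHalf_sq hT ht
  have e2 := congrArg abs e
  rw [abs_mul, abs_mul, abs_of_pos (by linarith : 0 < cosHalf T s + cosHalf T t),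
    abs_sub_comm t s] at e2
  have h3 : |sigma T ^ 2 * (t + s)| ≤ 2 := by
    rw [abs_mul, abs_of_pos (by positivity)]
    have h4 : |t + s| ≤ 2 := abs_le.2 ⟨by linarith [hs.1, ht.1], by linarith [hs.2, ht.2]⟩
    have h5 : sigma T ^ 2 ≤ 1 := pow_le_one₀ hσ.le hσ1.le
    nlinarith [abs_nonneg (t + s)]
  have h6 := mul_le_mul_of_nonneg_right h3 (abs_nonneg (s - t))
  have h7 := mul_le_mul_of_nonneg_left (add_le_add h1 h2) (abs_nonneg (cosHalf T s - cosHalf T t))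
  rw [inv_mul_eq_div, le_div_iff₀ h0]
  linarith

lemma hasDerivAt_subst {s : ℝ} (hs : s ∈ Icc (-1 : ℝ) 1) :
    HasDerivAt (subst T) (2 * T / Real.pi * sigma T * (cosHalf T s)⁻¹) s := by
  have h := abs_lt.1 (abs_sigma_mul_lt_one hT hs)
  have h1 : HasDerivAt (fun s => sigma T * s) (sigma T) s := by
    simpa using (hasDerivAt_id s).const_mul (sigma T)
  have h2 := ((Real.hasDerivAt_arcsin h.1.ne' h.2.ne).comp s h1).const_mul (2 * T / Real.pi)
  refine h2.congr_deriv ?_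
  rw [cosHalf]
  ring

lemma pi_div_mul_subst (s : ℝ) :
    Real.pi / T * subst T s = 2 * Real.arcsin (sigma T * s) := by
  have : T ≠ 0 := by linarith
  have := Real.pi_ne_zero
  rw [subst]
  field_simp

lemma cos_subst {s : ℝ} (hs : s ∈ Icc (-1 : ℝ) 1) :
    Real.cos (Real.pi / T * subst T s) = 1 - 2 * (sigma T * s) ^ 2 := by
  rw [pi_div_mul_subst hT, Real.cos_two_mul, Real.cos_arcsin, ← cosHalf, cosHalf_sq hT hs]
  ring

lemma sin_subst {s : ℝ} (hs : s ∈ Icc (-1 : ℝ) 1) :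
    Real.sin (Real.pi / T * subst T s) = 2 * (sigma T * s) * cosHalf T s := by
  have h := abs_le.1 (abs_sigma_mul_lt_one hT hs).le
  rw [pi_div_mul_subst hT, Real.sin_two_mul, Real.cos_arcsin, Real.sin_arcsin h.1 h.2, cosHalf]

/-- The interval [-1,1] is the degenerate ellipse, the image of the unit circle under the Joukowski
map. -/
lemma subst_mem_analyticityRegion {s : ℝ} (hs : s ∈ Icc (-1 : ℝ) 1) :
    (subst T s : ℂ) ∈ analyticityRegion T := by
  obtain ⟨u, hu, hus⟩ := exists_joukowski_eq hs
  have h := arcsin_mem_analyticityRegion hT hu.ge (hu.trans_lt (one_lt_rho hT))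
  rw [hus, ← Complex.ofReal_mul, arcsin_ofReal (abs_sigma_mul_lt_one hT hs).le,
    ← Complex.ofReal_mul] at h
  exact h

lemma evenPart_ofReal (F : ℂ → ℂ) {s : ℝ} (hs : s ∈ Icc (-1 : ℝ) 1) :
    evenPart T F s = (F (subst T s) + F (subst T (-s) : ℝ)) / 2 := by
  rw [evenPart, subst_neg, subst, ← Complex.ofReal_mul (sigma T),
    arcsin_ofReal (abs_sigma_mul_lt_one hT hs).le]
  push_cast
  rfl

lemma oddPart_ofReal (F : ℂ → ℂ) {s : ℝ} (hs : s ∈ Icc (-1 : ℝ) 1) :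
    oddPart T F s = (F (subst T s) - F (subst T (-s) : ℝ)) / 2 / cosHalf T s := by
  rw [oddPart, subst_neg, subst, ← Complex.ofReal_mul (sigma T),
    arcsin_ofReal (abs_sigma_mul_lt_one hT hs).le,
    cosArcsin_ofReal (abs_sigma_mul_lt_one hT hs).le, cosHalf]
  push_cast
  rfl

/-- In the variable `s`, the even part of an element of `G_n` is a polynomial and the odd part is
`√(1 - σ² s²)` times a polynomial. -/
lemma exists_polynomial_of_mem {n : ℕ} {g : ℝ → ℂ} (hg : g ∈ fourierSubmodule T n) :
    ∃ p q : Polynomial ℂ, p.natDegree ≤ 2 * n ∧ q.natDegree ≤ 2 * n - 1 ∧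
      ∀ s ∈ Icc (-1 : ℝ) 1, (g (subst T s) + g (subst T (-s))) / 2 = p.eval (s : ℂ) ∧
        (g (subst T s) - g (subst T (-s))) / 2 = cosHalf T s * q.eval (s : ℂ) := by
  set Y : Polynomial ℂ := 1 - Polynomial.C (2 * sigma T ^ 2 : ℂ) * Polynomial.X ^ 2 with hY
  have hYd : Y.natDegree ≤ 2 := by
    refine (Polynomial.natDegree_sub_le _ _).trans (max_le (by simp) ?_)
    exact Polynomial.natDegree_C_mul_X_pow_le _ _
  have hYe : ∀ s ∈ Icc (-1 : ℝ) 1, Y.eval (s : ℂ)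
      = Complex.cos ((Real.pi / T * subst T s : ℝ) : ℂ) := by
    intro s hs
    rw [← Complex.ofReal_cos, cos_subst hT hs, hY]
    simp
    ring
  induction hg using Submodule.span_induction with
  | mem g hg =>
    rcases hg with ⟨k, hk, rfl⟩ | ⟨k, hk, rfl⟩
    · have hk' : k ≤ n := hk
      refine ⟨(Polynomial.Chebyshev.T ℂ k).comp Y, 0, ?_, by simp, fun s hs => ⟨?_, ?_⟩⟩
      · refine Polynomial.natDegree_comp_le.trans ?_
        rw [Polynomial.Chebyshev.natDegree_T, Int.natAbs_natCast]
        nlinarith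
      · rw [Polynomial.eval_comp, hYe s hs, Polynomial.Chebyshev.T_complex_cos, subst_neg]
        simp only [cosWave, mul_neg, Real.cos_neg]
        rw [show Real.pi / T * k * subst T s = k * (Real.pi / T * subst T s) by ring]
        push_cast
        ring
      · rw [subst_neg]
        simp [cosWave]
    · rcases k with _ | k
      · exact ⟨0, 0, by simp, by simp, fun s _ => by simp [sinWave]⟩
      · have hk' : k + 1 ≤ n := hk
        -- With y = πx/T, sin((k+1)y) = U_k(cos y) sin y, and sin y is 2σs times `cosHalf T s`. The
        -- degree is at most 2k + 1, which is at most 2n - 1 because k + 1 ≤ n.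
        refine ⟨0, (Polynomial.Chebyshev.U ℂ k).comp Y
          * (Polynomial.C (2 * sigma T : ℂ) * Polynomial.X), by simp, ?_, fun s hs => ⟨?_, ?_⟩⟩
        · refine Polynomial.natDegree_mul_le.trans ?_
          have h1 := (Polynomial.natDegree_comp_le (p := Polynomial.Chebyshev.U ℂ k) (q := Y))
          rw [Polynomial.Chebyshev.natDegree_U_natCast] at h1
          have h2 := Polynomial.natDegree_C_mul_le (2 * sigma T : ℂ) Polynomial.X
          rw [Polynomial.natDegree_X] at h2
          have h3 : k * Y.natDegree ≤ k * 2 := Nat.mul_le_mul_left _ hYd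
          omega
        · rw [subst_neg]
          simp [sinWave]
        · have h1 := Polynomial.Chebyshev.U_complex_cos ((Real.pi / T * subst T s : ℝ) : ℂ) k
          rw [Polynomial.eval_mul, Polynomial.eval_comp, hYe s hs, subst_neg]
          simp only [sinWave, mul_neg, Real.sin_neg]
          rw [show Real.pi / T * ((k + 1 : ℕ) : ℝ) * subst T s
            = (k + 1) * (Real.pi / T * subst T s) by push_cast; ring]
          rw [← Complex.ofReal_sin, sin_subst hT hs] at h1
          simp only [Polynomial.eval_mul, Polynomial.eval_C, Polynomial.eval_X]
          push_cast at h1 ⊢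
          linear_combination -h1
  | zero => exact ⟨0, 0, by simp, by simp, fun s _ => by simp⟩
  | add g h _ _ hg hh =>
    obtain ⟨p, q, hp, hq, h1⟩ := hg
    obtain ⟨p', q', hp', hq', h2⟩ := hh
    refine ⟨p + p', q + q', (Polynomial.natDegree_add_le _ _).trans (max_le hp hp'),
      (Polynomial.natDegree_add_le _ _).trans (max_le hq hq'), fun s hs => ⟨?_, ?_⟩⟩
    · rw [Polynomial.eval_add, ← (h1 s hs).1, ← (h2 s hs).1]
      simp only [Pi.add_apply]
      ring
    · rw [Polynomial.eval_add, mul_add, ← (h1 s hs).2, ← (h2 s hs).2]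
      simp only [Pi.add_apply]
      ring
  | smul a g _ hg =>
    obtain ⟨p, q, hp, hq, h1⟩ := hg
    refine ⟨a • p, a • q, (Polynomial.natDegree_smul_le _ _).trans hp,
      (Polynomial.natDegree_smul_le _ _).trans hq, fun s hs => ⟨?_, ?_⟩⟩
    · rw [Polynomial.eval_smul, ← (h1 s hs).1]
      simp only [Pi.smul_apply, smul_eq_mul]
      ring
    · rw [Polynomial.eval_smul, smul_eq_mul, mul_left_comm, ← (h1 s hs).2]
      simp only [Pi.smul_apply, smul_eq_mul]
      ring

lemma integral_subst {w : ℝ → ℂ} (hw : ContinuousOn w (Icc (-1 : ℝ) 1)) :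
    ∫ x in (-1 : ℝ)..1, w x = ∫ s in (-1 : ℝ)..1,
      ((2 * T / Real.pi * sigma T * (cosHalf T s)⁻¹ : ℝ) : ℂ) * w (subst T s) := by
  have hI : uIcc (-1 : ℝ) 1 = Icc (-1) 1 := uIcc_of_le (by norm_num)
  have h := intervalIntegral.integral_deriv_smul_comp' (a := -1) (b := 1) (f := subst T) (g := w)
    (f' := fun s => 2 * T / Real.pi * sigma T * (cosHalf T s)⁻¹)
    (fun s hs => hasDerivAt_subst hT (by rwa [hI] at hs))
    (continuousOn_const.mul (continuous_cosHalf.continuousOn.inv₀ fun s hs =>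
      (cosHalf_pos hT (by rwa [hI] at hs)).ne'))
    (hw.mono (by
      rintro _ ⟨s, hs, rfl⟩
      exact subst_mem hT (by rwa [hI] at hs)))
  rw [subst_neg, subst_one hT] at h
  rw [← h]
  exact intervalIntegral.integral_congr fun s _ => by simp

end Substitution

/-! ### Error bounds for the even and the odd part. -/

/-- Reflection s ↦ -s. Used with e = ±1, it makes the moments of the wrong parity vanish, so only
those reached by test functions in G_n remain, and no parity of g or its polynomials has to be
proved. -/
lemma integral_symmetrized {D : ℝ → ℂ} {φ : ℝ → ℝ} (hD : ContinuousOn D (Icc (-1 : ℝ) 1))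
    (hφ : ContinuousOn φ (Icc (-1 : ℝ) 1)) (hφe : ∀ s, φ (-s) = φ s) (e : ℂ) (j : ℕ) :
    ∫ s in (-1 : ℝ)..1, (D s + e * D (-s)) / 2 * φ s * (s : ℂ) ^ j
      = (1 + e * (-1) ^ j) / 2 * ∫ s in (-1 : ℝ)..1, D s * φ s * (s : ℂ) ^ j := by
  have hφc : ContinuousOn (fun s : ℝ => (φ s : ℂ)) (Icc (-1 : ℝ) 1) :=
    Complex.continuous_ofReal.comp_continuousOn hφ
  have hDn : ContinuousOn (fun s => D (-s)) (Icc (-1 : ℝ) 1) :=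
    hD.comp continuous_neg.continuousOn fun s hs => neg_mem_Icc_neg_one_one hs
  have hp : ContinuousOn (fun s : ℝ => (s : ℂ) ^ j) (Icc (-1 : ℝ) 1) :=
    (Complex.continuous_ofReal.pow j).continuousOn
  have h1 : IntervalIntegrable (fun s => D s * φ s * (s : ℂ) ^ j) volume (-1) 1 :=
    intervalIntegrable_of_continuousOn_Icc ((hD.mul hφc).mul hp)
  have h2 : IntervalIntegrable (fun s => D (-s) * φ s * (s : ℂ) ^ j) volume (-1) 1 :=
    intervalIntegrable_of_continuousOn_Icc ((hDn.mul hφc).mul hp)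
  have h3 : ∫ s in (-1 : ℝ)..1, D (-s) * φ s * (s : ℂ) ^ j
      = (-1) ^ j * ∫ s in (-1 : ℝ)..1, D s * φ s * (s : ℂ) ^ j := by
    have := intervalIntegral.integral_comp_neg (a := -1) (b := 1)
      (fun s : ℝ => D (-s) * φ s * (s : ℂ) ^ j)
    rw [neg_neg] at this
    rw [← this, ← intervalIntegral.integral_const_mul]
    refine intervalIntegral.integral_congr fun s _ => ?_
    simp only [neg_neg, hφe]
    push_cast
    rw [neg_pow]
    ring
  have h4 : ∀ s : ℝ, (D s + e * D (-s)) / 2 * φ s * (s : ℂ) ^ j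
      = 1 / 2 * (D s * φ s * (s : ℂ) ^ j) + e / 2 * (D (-s) * φ s * (s : ℂ) ^ j) := by
    intro s; ring
  simp_rw [h4]
  rw [intervalIntegral.integral_add (h1.const_mul _) (h2.const_mul _),
    intervalIntegral.integral_const_mul, intervalIntegral.integral_const_mul, h3]
  ring

section Main

variable {T : ℝ} (hT : 1 < T) {f : ℝ → ℂ} {F : ℂ → ℂ}
  (hF : AnalyticOnNhd ℂ F (analyticityRegion T)) (hFf : ∀ x ∈ Icc (-1 : ℝ) 1, F (x : ℂ) = f x)
include hT hF hFf

lemma continuousOn_of_analytic_extension : ContinuousOn f (Icc (-1 : ℝ) 1) := by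
  have h1 : ContinuousOn (fun x : ℝ => F (x : ℂ)) (Icc (-1 : ℝ) 1) := by
    intro x hx
    obtain ⟨s, hs, rfl⟩ := exists_subst_eq hT hx
    exact ((hF _ (subst_mem_analyticityRegion hT hs)).continuousAt.comp
      Complex.continuous_ofReal.continuousAt).continuousWithinAt
  exact h1.congr fun x hx => (hFf x hx).symm

/-- The even part of g is the least squares polynomial of degree 2n for the even part of f, with the
Jacobian of the substitution, up to a constant, as weight. -/
lemma exists_even_error_bound : ∃ C : ℝ, ∀ (n : ℕ) (g : ℝ → ℂ), IsFourierExtension T n f g →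
    ∀ s ∈ Icc (-1 : ℝ) 1,
      ‖(f (subst T s) - g (subst T s) + (f (subst T (-s)) - g (subst T (-s)))) / 2‖
        ≤ C * (rho T)⁻¹ ^ (2 * n) := by
  obtain ⟨A, hA⟩ := exists_polynomial_approx_evenPart hT hF
  have hfc := continuousOn_of_analytic_extension hT hF hFf
  have hm := cosHalf_one_pos hT
  have hHc : ContinuousOn (fun s : ℝ => evenPart T F s) (Icc (-1 : ℝ) 1) := by
    have h1 : ContinuousOn (fun s : ℝ => (f (subst T s) + f (subst T (-s))) / 2)
        (Icc (-1 : ℝ) 1) :=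
      ((hfc.comp continuous_subst.continuousOn fun s hs => subst_mem hT hs).add
        (hfc.comp (continuous_subst.comp continuous_neg).continuousOn fun s hs =>
          subst_mem hT (neg_mem_Icc_neg_one_one hs))).div_const 2
    refine h1.congr fun s hs => ?_
    rw [evenPart_ofReal hT F hs, hFf _ (subst_mem hT hs),
      hFf _ (subst_mem hT (neg_mem_Icc_neg_one_one hs))]
  have hφc : ContinuousOn (fun s => (cosHalf T s)⁻¹) (Icc (-1 : ℝ) 1) :=
    continuous_cosHalf.continuousOn.inv₀ fun s hs => (cosHalf_pos hT hs).ne'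
  refine ⟨projectionConst (rho T) A ((cosHalf T 1)⁻¹ ^ 3) 1 (cosHalf T 1)⁻¹,
    fun n g hg s hs => ?_⟩
  have hg' := mem_fourierSpace_iff.1 hg.1
  obtain ⟨p, q, hp, -, hpq⟩ := exists_polynomial_of_mem hT hg'
  have hdc : ContinuousOn (fun x => f x - g x) (Icc (-1 : ℝ) 1) :=
    hfc.sub (continuous_of_mem hg').continuousOn
  have hDc : ContinuousOn (fun s => f (subst T s) - g (subst T s)) (Icc (-1 : ℝ) 1) :=
    hdc.comp continuous_subst.continuousOn fun s hs => subst_mem hT hs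
  have herr : ∀ s ∈ Icc (-1 : ℝ) 1, evenPart T F s - p.eval (s : ℂ)
      = (f (subst T s) - g (subst T s) + 1 * (f (subst T (-s)) - g (subst T (-s)))) / 2 := by
    intro s hs
    rw [evenPart_ofReal hT F hs, hFf _ (subst_mem hT hs),
      hFf _ (subst_mem hT (neg_mem_Icc_neg_one_one hs)), ← (hpq s hs).1]
    ring
  have horth : ∀ j ≤ 2 * n, ∫ s in (-1 : ℝ)..1,
      (evenPart T F s - p.eval (s : ℂ)) * ((cosHalf T s)⁻¹ : ℝ) * (s : ℂ) ^ j = 0 := by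
    intro j hj
    have e1 : ∫ s in (-1 : ℝ)..1,
        (evenPart T F s - p.eval (s : ℂ)) * ((cosHalf T s)⁻¹ : ℝ) * (s : ℂ) ^ j
        = ∫ s in (-1 : ℝ)..1, (f (subst T s) - g (subst T s)
          + 1 * (f (subst T (-s)) - g (subst T (-s)))) / 2
            * ((cosHalf T s)⁻¹ : ℝ) * (s : ℂ) ^ j := by
      refine intervalIntegral.integral_congr fun s hs => ?_
      rw [uIcc_of_le (by norm_num)] at hs
      simp only [herr s hs]
    rw [e1, integral_symmetrized (D := fun s => f (subst T s) - g (subst T s)) hDc hφc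
      (fun s => by simp only [cosHalf_neg])]
    rcases Nat.even_or_odd' j with ⟨i, rfl | rfl⟩
    -- Even moments j = 2i with i ≤ n come from testing against (1 - cos(πx/T))^i; odd moments carry
    -- the factor (1 + (-1)^j)/2 = 0.
    · have hmem : (1 - cosWave T 1) ^ i * cosWave T 0 ∈ fourierSubmodule T n :=
        fourierSubmodule_mono (by omega)
          (one_sub_cosWave_pow_mul_mem (cosWave_mem (n := 0) le_rfl) i)
      have h0 := integral_error_mul_eq_zero hfc hg hmem
      rw [integral_subst hT
        (w := fun x => (f x - g x) * ((1 - cosWave T 1) ^ i * cosWave T 0) x)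
        (hdc.mul (continuous_of_mem hmem).continuousOn)] at h0
      have e2 : ∀ s ∈ uIcc (-1 : ℝ) 1, ((2 * T / Real.pi * sigma T * (cosHalf T s)⁻¹ : ℝ) : ℂ)
          * ((f (subst T s) - g (subst T s))
            * ((1 - cosWave T 1) ^ i * cosWave T 0) (subst T s))
          = (2 * T / Real.pi * sigma T * (2 * sigma T ^ 2) ^ i : ℂ)
            * ((f (subst T s) - g (subst T s)) * ((cosHalf T s)⁻¹ : ℝ) * (s : ℂ) ^ (2 * i)) := by
        intro s hs
        rw [uIcc_of_le (by norm_num)] at hs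
        simp only [Pi.mul_apply, Pi.pow_apply, Pi.sub_apply, Pi.one_apply, cosWave, Nat.cast_one,
          mul_one, Nat.cast_zero, mul_zero, zero_mul, Real.cos_zero, cos_subst hT hs]
        push_cast
        rw [show (1 - (1 - 2 * (sigma T * s) ^ 2) : ℂ) = 2 * sigma T ^ 2 * s ^ 2 by ring, mul_pow,
          pow_mul]
        ring
      rw [intervalIntegral.integral_congr e2, intervalIntegral.integral_const_mul] at h0
      have hne : (2 * T / Real.pi * sigma T * (2 * sigma T ^ 2) ^ i : ℂ) ≠ 0 := by
        have h1 := sigma_pos hT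
        have h2 : 0 < T := by linarith
        have h3 := Real.pi_pos
        exact_mod_cast (by positivity : 0 < 2 * T / Real.pi * sigma T * (2 * sigma T ^ 2) ^ i).ne'
      rw [(mul_eq_zero.1 h0).resolve_left hne, mul_zero]
    · rw [pow_succ, pow_mul]
      norm_num
  have := norm_sub_weighted_projection_le (one_lt_rho hT) hHc hA hφc one_pos
    (M := (cosHalf T 1)⁻¹) (L := (cosHalf T 1)⁻¹ ^ 3)
    (fun x hx => (one_le_inv₀ (cosHalf_pos hT hx)).2 (cosHalf_le_one x))
    (fun x hx => inv_anti₀ hm (cosHalf_one_le hT hx)) (by positivity) ?_ hp horth hs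
  · rw [herr s hs, one_mul] at this
    exact this
  · intro x hx t ht
    have hx0 := cosHalf_pos hT hx
    have ht0 := cosHalf_pos hT ht
    rw [inv_sub_inv hx0.ne' ht0.ne', abs_div, abs_of_pos (mul_pos hx0 ht0), abs_sub_comm,
      div_eq_mul_inv, mul_inv]
    have h1 := inv_anti₀ hm (cosHalf_one_le hT hx)
    have h2 := inv_anti₀ hm (cosHalf_one_le hT ht)
    calc _ ≤ (cosHalf T 1)⁻¹ * |x - t| * ((cosHalf T 1)⁻¹ * (cosHalf T 1)⁻¹) := by
          gcongr
          exact abs_cosHalf_sub_le hT hx ht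
      _ = _ := by ring

/-- Both the error and the odd test functions contain a factor √(1-σ²s²); with the Jacobian this
leaves the weight √(1-σ²s²) for the polynomial problem of degree 2n - 1. For n = 0 the truncated
degree is 0, and the single moment needed vanishes by parity. -/
lemma exists_odd_error_bound : ∃ C : ℝ, ∀ (n : ℕ) (g : ℝ → ℂ), IsFourierExtension T n f g →
    ∀ s ∈ Icc (-1 : ℝ) 1,
      ‖(f (subst T s) - g (subst T s) - (f (subst T (-s)) - g (subst T (-s)))) / 2‖
        ≤ C * (rho T)⁻¹ ^ (2 * n - 1) := by
  obtain ⟨A, hA⟩ := exists_polynomial_approx_oddPart hT hF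
  have hfc := continuousOn_of_analytic_extension hT hF hFf
  have hm := cosHalf_one_pos hT
  have hHc : ContinuousOn (fun s : ℝ => oddPart T F s) (Icc (-1 : ℝ) 1) := by
    have h1 : ContinuousOn (fun s : ℝ => (f (subst T s) - f (subst T (-s))) / 2 / cosHalf T s)
        (Icc (-1 : ℝ) 1) :=
      (((hfc.comp continuous_subst.continuousOn fun s hs => subst_mem hT hs).sub
        (hfc.comp (continuous_subst.comp continuous_neg).continuousOn fun s hs =>
          subst_mem hT (neg_mem_Icc_neg_one_one hs))).div_const 2).div
        (Complex.continuous_ofReal.comp continuous_cosHalf).continuousOn fun s hs => by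
          simpa using (cosHalf_pos hT hs).ne'
    refine h1.congr fun s hs => ?_
    rw [oddPart_ofReal hT F hs, hFf _ (subst_mem hT hs),
      hFf _ (subst_mem hT (neg_mem_Icc_neg_one_one hs))]
  refine ⟨projectionConst (rho T) A (cosHalf T 1)⁻¹ (cosHalf T 1) 1, fun n g hg s hs => ?_⟩
  have hg' := mem_fourierSpace_iff.1 hg.1
  obtain ⟨p, q, -, hq, hpq⟩ := exists_polynomial_of_mem hT hg'
  have hdc : ContinuousOn (fun x => f x - g x) (Icc (-1 : ℝ) 1) :=
    hfc.sub (continuous_of_mem hg').continuousOn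
  have hDc : ContinuousOn (fun s => f (subst T s) - g (subst T s)) (Icc (-1 : ℝ) 1) :=
    hdc.comp continuous_subst.continuousOn fun s hs => subst_mem hT hs
  have herr : ∀ s ∈ Icc (-1 : ℝ) 1, (oddPart T F s - q.eval (s : ℂ)) * cosHalf T s
      = (f (subst T s) - g (subst T s) + -1 * (f (subst T (-s)) - g (subst T (-s)))) / 2 := by
    intro s hs
    have h0 : (cosHalf T s : ℂ) ≠ 0 := by exact_mod_cast (cosHalf_pos hT hs).ne'
    rw [oddPart_ofReal hT F hs, hFf _ (subst_mem hT hs),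
      hFf _ (subst_mem hT (neg_mem_Icc_neg_one_one hs)), sub_mul, div_mul_cancel₀ _ h0,
      mul_comm (q.eval (s : ℂ)), ← (hpq s hs).2]
    ring
  have horth : ∀ j ≤ 2 * n - 1, ∫ s in (-1 : ℝ)..1,
      (oddPart T F s - q.eval (s : ℂ)) * (cosHalf T s : ℝ) * (s : ℂ) ^ j = 0 := by
    intro j hj
    have e1 : ∫ s in (-1 : ℝ)..1,
        (oddPart T F s - q.eval (s : ℂ)) * (cosHalf T s : ℝ) * (s : ℂ) ^ j
        = ∫ s in (-1 : ℝ)..1, (f (subst T s) - g (subst T s)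
          + -1 * (f (subst T (-s)) - g (subst T (-s)))) / 2 * ((1 : ℝ) : ℂ) * (s : ℂ) ^ j := by
      refine intervalIntegral.integral_congr fun s hs => ?_
      rw [uIcc_of_le (by norm_num)] at hs
      simp only [herr s hs, Complex.ofReal_one, mul_one]
    rw [e1, integral_symmetrized (D := fun s => f (subst T s) - g (subst T s)) (φ := fun _ => 1)
      hDc continuousOn_const (fun s => rfl)]
    rcases Nat.even_or_odd' j with ⟨i, rfl | rfl⟩
    · rw [pow_mul]
      norm_num
    -- The factor `cosHalf` of sin(πx/T) cancels the Jacobian, so the moments appear with weight 1.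
    -- Membership needs i + 1 ≤ n, which is 2i + 1 ≤ 2n - 1.
    · have hmem : (1 - cosWave T 1) ^ i * sinWave T 1 ∈ fourierSubmodule T n :=
        fourierSubmodule_mono (by omega)
          (one_sub_cosWave_pow_mul_mem (sinWave_mem (n := 1) le_rfl) i)
      have h0 := integral_error_mul_eq_zero hfc hg hmem
      rw [integral_subst hT
        (w := fun x => (f x - g x) * ((1 - cosWave T 1) ^ i * sinWave T 1) x)
        (hdc.mul (continuous_of_mem hmem).continuousOn)] at h0
      have e2 : ∀ s ∈ uIcc (-1 : ℝ) 1, ((2 * T / Real.pi * sigma T * (cosHalf T s)⁻¹ : ℝ) : ℂ)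
          * ((f (subst T s) - g (subst T s))
            * ((1 - cosWave T 1) ^ i * sinWave T 1) (subst T s))
          = (2 * T / Real.pi * sigma T * (2 * sigma T ^ 2) ^ i * (2 * sigma T) : ℂ)
            * ((f (subst T s) - g (subst T s)) * ((1 : ℝ) : ℂ) * (s : ℂ) ^ (2 * i + 1)) := by
        intro s hs
        rw [uIcc_of_le (by norm_num)] at hs
        have hc0 : (cosHalf T s : ℂ) ≠ 0 := by exact_mod_cast (cosHalf_pos hT hs).ne'
        simp only [Pi.mul_apply, Pi.pow_apply, Pi.sub_apply, Pi.one_apply, cosWave, sinWave,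
          Nat.cast_one, mul_one, cos_subst hT hs, sin_subst hT hs]
        push_cast
        rw [show (1 - (1 - 2 * (sigma T * s) ^ 2) : ℂ) = 2 * sigma T ^ 2 * s ^ 2 by ring, mul_pow,
          pow_succ (s : ℂ) (2 * i), pow_mul]
        linear_combination (2 * T / Real.pi * sigma T * (2 * sigma T ^ 2) ^ i * (2 * sigma T)
          * (f (subst T s) - g (subst T s)) * (s ^ 2) ^ i * s : ℂ) * inv_mul_cancel₀ hc0
      rw [intervalIntegral.integral_congr e2, intervalIntegral.integral_const_mul] at h0
      have hne : (2 * T / Real.pi * sigma T * (2 * sigma T ^ 2) ^ i * (2 * sigma T) : ℂ) ≠ 0 := by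
        have h1 := sigma_pos hT
        have h2 : 0 < T := by linarith
        have h3 := Real.pi_pos
        exact_mod_cast (by positivity :
          0 < 2 * T / Real.pi * sigma T * (2 * sigma T ^ 2) ^ i * (2 * sigma T)).ne'
      rw [(mul_eq_zero.1 h0).resolve_left hne, mul_zero]
  have := norm_sub_weighted_projection_le (one_lt_rho hT) hHc hA
    continuous_cosHalf.continuousOn hm (M := 1) (L := (cosHalf T 1)⁻¹)
    (fun x hx => cosHalf_one_le hT hx) (fun x _ => cosHalf_le_one x) (by positivity)
    (fun x hx t ht => abs_cosHalf_sub_le hT hx ht) hq horth hs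
  refine le_trans ?_ this
  have h1 := herr s hs
  rw [neg_one_mul, ← sub_eq_add_neg] at h1
  rw [← h1, norm_mul, Complex.norm_real, Real.norm_eq_abs, abs_of_pos (cosHalf_pos hT hs)]
  exact mul_le_of_le_one_right (norm_nonneg _) (cosHalf_le_one s)

end Main

end FourierExtension

end

theorem mainTheorem3 (T : ℝ) (hT : 1 < T) (f : ℝ → ℂ)
    (hf : FourierExtension.SufficientlyAnalytic T f) :
    (∀ n : ℕ, ∃! g : ℝ → ℂ, FourierExtension.IsFourierExtension T n f g) ∧
    ∃ C : ℝ, ∀ (n : ℕ) (g : ℝ → ℂ), FourierExtension.IsFourierExtension T n f g →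
      ∀ x ∈ Set.Icc (-1 : ℝ) 1,
        ‖f x - g x‖ ≤ C * FourierExtension.E T ^ (-(n : ℤ)) := by
  obtain ⟨F, hF, hFf⟩ := hf
  refine ⟨fun n => FourierExtension.existsUnique_isFourierExtension
    (FourierExtension.continuousOn_of_analytic_extension hT hF hFf), ?_⟩
  obtain ⟨C₁, h₁⟩ := FourierExtension.exists_even_error_bound hT hF hFf
  obtain ⟨C₂, h₂⟩ := FourierExtension.exists_odd_error_bound hT hF hFf
  have hρ := FourierExtension.one_lt_rho hT
  have hρ0 : 0 < FourierExtension.rho T := by linarith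
  -- The odd bound has one power of ρ less, so its constant is multiplied by ρ. The absolute value
  -- allows enlarging the bound at n = 0, where the truncated exponent 2n - 1 is 0 and only 1 ≤ ρ is
  -- available.
  refine ⟨C₁ + |C₂| * FourierExtension.rho T, fun n g hg x hx => ?_⟩
  obtain ⟨s, hs, rfl⟩ := FourierExtension.exists_subst_eq hT hx
  have hE : FourierExtension.E T ^ (-(n : ℤ)) = (FourierExtension.rho T)⁻¹ ^ (2 * n) := by
    rw [FourierExtension.E_eq_rho_sq, zpow_neg, zpow_natCast, ← pow_mul, inv_pow]
  have hodd : C₂ * (FourierExtension.rho T)⁻¹ ^ (2 * n - 1)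
      ≤ |C₂| * FourierExtension.rho T * (FourierExtension.rho T)⁻¹ ^ (2 * n) := by
    rw [mul_assoc]
    refine mul_le_mul (le_abs_self _) ?_ (by positivity) (abs_nonneg _)
    rcases n with _ | n
    · simpa using hρ.le
    · rw [show 2 * (n + 1) - 1 = 2 * n + 1 by omega, show 2 * (n + 1) = 2 * n + 1 + 1 by omega,
        pow_succ _ (2 * n + 1)]
      apply le_of_eq
      field_simp
  have e : f (FourierExtension.subst T s) - g (FourierExtension.subst T s)
      = (f (FourierExtension.subst T s) - g (FourierExtension.subst T s)
        + (f (FourierExtension.subst T (-s)) - g (FourierExtension.subst T (-s)))) / 2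
        + (f (FourierExtension.subst T s) - g (FourierExtension.subst T s)
        - (f (FourierExtension.subst T (-s)) - g (FourierExtension.subst T (-s)))) / 2 := by ring
  rw [hE, e, add_mul]
  exact (norm_add_le _ _).trans (add_le_add (h₁ n g hg s hs) ((h₂ n g hg s hs).trans hodd))
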